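/- Let $n\ge 1$, $S=\{1,\dots,n\}$. For each $i\in S$ let $A_i,B_i$ be nonempty finite sets and, for $a\in A_i$, $b\in B_i$, let $P_i^{ab}$ be a probability vector on $S$ (with real entries). The associated payment-free Shapley operator $F:\mathbb R^n\to\mathbb R^n$ is $$[F(x)]_i=\min_{a\in A_i}\max_{b\in B_i}\sum_{j\in S}(P_i^{ab})_j\,x_j .$$ Let $m_2=\sum_{i\in S}|A_i||B_i|$ and $m=\max_{i\in S}\max(|A_i|,|B_i|)$. For $I\subset S$, consider the problem: does $F$ have a fixed point $u\in\mathbb R^n$ with $\{i\in S: u_i=\min_{j\in S} u_j\}=I$? Notation. $\mathbf 1_K$ is the vector with entries $1$ on $K$ and $0$ elsewhere. The upper Boolean abstraction of $F$ is $[F^+(x)]_i=\min_{a\in A_i}\max_{b\in B_i}\max_{j:(P_i^{ab})_j>0}x_j$. Put $\mathcal F^-=\{I\subset S: F(\mathbf 1_{S\setminus I})\le \mathbf 1_{S\setminus I}\}$, $\mathcal F^+=\{J\subset S:\mathbf 1_J\le F(\mathbf 1_J)\}$, and let $\Phi_F(I)$ be the union of all $J\in\mathcal F^+$ with $I\cap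 J=\emptyset$, and $\Phi_F^\star(J)$ the union of all $I\in\mathcal F^-$ with $I\cap J=\emptyset$. Algorithm. Input: $S,(A_i),(B_i),P$ and $I\subset S$. If $I=\emptyset$, return false; else if $I=S$, return true. Otherwise repeat the following loop: 1. if $F^+(\mathbf 1_{S\setminus I})\ne\mathbf 1_{S\setminus I}$ or $\Phi_F(I)=\emptyset$, return false; 2. else, if $\Phi_F^\star(\Phi_F(I))=I$, return true; 3. else, let $K=\Phi_F^\star(\Phi_F(I))$ and replace simultaneously $S$ by $K$; $A_i$, for $i\in K$, by $A_i^\vartriangle=\{a\in A_i: (P_i^{ab})_j=0\ \text{for all } b\in B_i,\ j\in S\setminus K\}$; $P_i^{ab}$ by its restriction to $K$; and $F$ by the operator $F^\vartriangle:\mathbb R^K\to\mathbb R^K$, $[F^\vartriangle(x)]_i=\min_{a\in A_i^\vartriangle}\max_{b\in B_i}\sum_{j\in K}(P_i^{ab})_jx_j$. Theorem. On every input this algorithm terminates, after at most $n$ iterations of its loop, and it returns true if and only if $F$ has a fixed point whose set of minimizing indices is exactly $I$. Moreover it runs in $O(n^2m_2)\le O(n^3m^2)$ time: one has $n^2m_2\le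 n^3m^2$, and there are one program of a unit-cost random access machine and one constant $C$ such that, on every input, the program goes through the same iterations as the algorithm (it prints the current $S$ and $(A_i)$ at the beginning of each iteration, and finally the returned answer) and halts after at most $C\,n^2m_2$ steps. Here the machine has registers and arrays of natural numbers with indirect addressing; it can copy, increment, decrement and compare numbers, each instruction or test costing one step; it is given $n$, the numbers $|A_i|$ and $|B_i|$ and the characteristic vector of $I$ in its memory, and the entries of $P$ on a read-only random access tape, where it can only test whether an entry is positive. -/

import Mathlib

/-! ### Payment-free Shapley operators, Boolean abstraction, Galois connection

The definitions of this section are for an arbitrary state space `S`, action spaces `A i`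
(player MIN) and `B i` (player MAX), and transition function `P`, with `P i a b j` the probability
of moving from `i` to `j` under the actions `a` and `b`. They are used for nonempty finite `S`,
`A i`, `B i`; then every infimum (supremum) below is a minimum (maximum). -/

namespace ShapleyGame

section Operators

variable {S : Type*} {A B : S → Type*}

/-- The payment-free Shapley operator
`[F(x)]_i = min_{a ∈ A_i} max_{b ∈ B_i} ∑_j (P_i^{ab})_j x_j`. -/
noncomputable def shapley [Fintype S] (P : (i : S) → A i → B i → S → ℝ) (x : S → ℝ) : S → ℝ :=
  fun i => ⨅ a : A i, ⨆ b : B i, ∑ j : S, P i a b j * x j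

/-- The upper Boolean abstraction
`[F⁺(x)]_i = min_{a ∈ A_i} max_{b ∈ B_i} max_{j : (P_i^{ab})_j > 0} x_j`. -/
noncomputable def upperAbstraction (P : (i : S) → A i → B i → S → ℝ) (x : S → ℝ) : S → ℝ :=
  fun i => ⨅ a : A i, ⨆ b : B i, ⨆ j : {j : S // 0 < P i a b j}, x j

/-- The vector `1_K`, with entries `1` on `K` and `0` elsewhere. -/
noncomputable def ind (K : Set S) : S → ℝ := K.indicator (fun _ => 1)

/-- The family `𝓕⁻` of the sets `I` with `F(1_{S∖I}) ≤ 1_{S∖I}`. -/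
def lowerFamily [Fintype S] (P : (i : S) → A i → B i → S → ℝ) : Set (Set S) :=
  {I | shapley P (ind Iᶜ) ≤ ind Iᶜ}

/-- The family `𝓕⁺` of the sets `J` with `1_J ≤ F(1_J)`. -/
def upperFamily [Fintype S] (P : (i : S) → A i → B i → S → ℝ) : Set (Set S) :=
  {J | ind J ≤ shapley P (ind J)}

/-- `Φ(I)`: the union of the members of `𝓕⁺` disjoint from `I`. -/
def Phi [Fintype S] (P : (i : S) → A i → B i → S → ℝ) (I : Set S) : Set S :=
  ⋃₀ {J | J ∈ upperFamily P ∧ I ∩ J = ∅}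

/-- `Φ*(J)`: the union of the members of `𝓕⁻` disjoint from `J`. -/
def PhiStar [Fintype S] (P : (i : S) → A i → B i → S → ℝ) (J : Set S) : Set S :=
  ⋃₀ {I | I ∈ lowerFamily P ∧ I ∩ J = ∅}

/-- The actions of player MIN in state `i` that keep the state in `K` for sure. -/
def forcingActions (P : (i : S) → A i → B i → S → ℝ) (K : Set S) (i : S) : Set (A i) :=
  {a | ∀ b : B i, ∀ j : S, j ∉ K → P i a b j = 0}

/-- The set of states where `u` attains its minimum. -/
def argmin (u : S → ℝ) : Set S := {i | ∀ j, u i ≤ u j}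

end Operators

/-! ### Games with finite action spaces -/

/-- The data `(A_i)`, `(B_i)`, `P` of a payment-free game on the states `{0, …, n-1}`, with nonempty
finite action spaces `A_i = {0, …, numA i - 1}` and `B_i = {0, …, numB i - 1}`. -/
structure Game (n : ℕ) where
  numA : Fin n → ℕ
  numB : Fin n → ℕ
  numA_pos : ∀ i, 0 < numA i
  numB_pos : ∀ i, 0 < numB i
  P : (i : Fin n) → Fin (numA i) → Fin (numB i) → Fin n → ℝ
  P_nonneg : ∀ i a b j, 0 ≤ P i a b j
  P_sum : ∀ i a b, ∑ j, P i a b j = 1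

namespace Game

variable {n : ℕ}

/-- The number `m₂` of triples `(i, a, b)`. -/
def m₂ (G : Game n) : ℕ := ∑ i, G.numA i * G.numB i

/-- The greatest cardinality `m` of the action spaces. -/
def m (G : Game n) : ℕ := Finset.univ.sup fun i => max (G.numA i) (G.numB i)

end Game

/-! ### The algorithm, as pseudo-code -/

/-- The variables of the loop: the current state space `S` and the current action spaces `A_i` of
player MIN. The action spaces of player MAX never change, and the current transition probability is
the restriction of the original one, see `LoopState.P`. -/
@[ext]
structure LoopState {n : ℕ} (G : Game n) where
  S : Finset (Fin n)
  A : (i : Fin n) → Finset (Fin (G.numA i))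

namespace LoopState

variable {n : ℕ} {G : Game n}

/-- The initial value: the whole game. -/
def full (G : Game n) : LoopState G := ⟨Finset.univ, fun _ => Finset.univ⟩

/-- The current transition probability, over the current state space and action spaces. -/
def P (σ : LoopState G) : (i : σ.S) → σ.A i → Fin (G.numB i) → σ.S → ℝ :=
  fun i a b j => G.P i a b j

/-- `I` as a subset of the current state space. -/
def sub (σ : LoopState G) (I : Finset (Fin n)) : Set σ.S := {i | (i : Fin n) ∈ I}

/-- The closure `Φ*(Φ(I))` for the current operator. -/
def clo (σ : LoopState G) (I : Finset (Fin n)) : Set σ.S := PhiStar σ.P (Phi σ.P (σ.sub I))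

/-- The first test of the loop: `F⁺(1_{S∖I}) ≠ 1_{S∖I}` or `Φ(I) = ∅`. -/
def Rejects (σ : LoopState G) (I : Finset (Fin n)) : Prop :=
  upperAbstraction σ.P (ind (σ.sub I)ᶜ) ≠ ind (σ.sub I)ᶜ ∨ Phi σ.P (σ.sub I) = ∅

open Classical in
/-- The assignment `A_i ← A_i^△`, `P ← P^△`, `F ← F^△`, `S ← Φ*(Φ(I))`, where `A_i^△` consists of
the current actions of player MIN that keep the state in `Φ*(Φ(I))`. Outside the new state space,
where there are no actions any more, `A_i` becomes empty. -/
noncomputable def reduce (σ : LoopState G) (I : Finset (Fin n)) : LoopState G where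
  S := Finset.univ.filter fun i => ∃ hi : i ∈ σ.S, (⟨i, hi⟩ : σ.S) ∈ σ.clo I
  A := fun i => Finset.univ.filter fun a => ∃ (hi : i ∈ σ.S) (ha : a ∈ σ.A i),
    (⟨i, hi⟩ : σ.S) ∈ σ.clo I ∧ (⟨a, ha⟩ : σ.A i) ∈ forcingActions σ.P (σ.clo I) ⟨i, hi⟩

end LoopState

/-- `Loop I σ l ans`: entered with the variables `σ`, the loop terminates and returns `ans`, and `l`
lists the values of the variables at the beginning of the successive iterations. -/
inductive Loop {n : ℕ} {G : Game n} (I : Finset (Fin n)) :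
    LoopState G → List (LoopState G) → Bool → Prop
  | reject (σ : LoopState G) (h : σ.Rejects I) : Loop I σ [σ] false
  | accept (σ : LoopState G) (h : ¬ σ.Rejects I) (hc : σ.clo I = σ.sub I) : Loop I σ [σ] true
  | reduce (σ : LoopState G) (h : ¬ σ.Rejects I) (hc : σ.clo I ≠ σ.sub I)
      (l : List (LoopState G)) (ans : Bool) (hl : Loop I (σ.reduce I) l ans) :
      Loop I σ (σ :: l) ans

/-- `Algorithm G I l ans`: on the input `G`, `I` the algorithm terminates and returns `ans`, and `l`
lists the values of the variables at the beginning of the successive iterations of its loop. -/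
inductive Algorithm {n : ℕ} (G : Game n) (I : Finset (Fin n)) :
    List (LoopState G) → Bool → Prop
  | empty (h : I = ∅) : Algorithm G I [] false
  | whole (h : I ≠ ∅) (h' : I = Finset.univ) : Algorithm G I [] true
  | loop (h : I ≠ ∅) (h' : I ≠ Finset.univ) (l : List (LoopState G)) (ans : Bool)
      (hl : Loop I (LoopState.full G) l ans) : Algorithm G I l ans

/-! ### The machine model

A random access machine with structured control flow. It has registers and arrays of natural numbers
with indirect addressing, a read-only two-dimensional input tape of real numbers, which can only be
tested for positivity, and a write-only output tape. Numbers can only be copied, incremented,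
decremented and compared; so no number ever exceeds the largest one in the input and in the program
by more than the number of steps made. Every instruction and every test costs one step. -/

/-- The contents of the read-write memory and of the output tape. -/
structure Memory where
  reg : ℕ → ℕ
  arr : ℕ → ℕ → ℕ
  out : List ℕ

/-- Programs. -/
inductive Program
  /-- do nothing -/
  | skip
  /-- `reg x := k` -/
  | const (x k : ℕ)
  /-- `reg x := reg y` -/
  | copy (x y : ℕ)
  /-- `reg x := reg x + 1` -/
  | inc (x : ℕ)
  /-- `reg x := reg x - 1` (and `0` stays `0`) -/
  | dec (x : ℕ)
  /-- `reg x := arr k [reg y]` -/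
  | load (x k y : ℕ)
  /-- `arr k [reg x] := reg y` -/
  | store (k x y : ℕ)
  /-- `reg x := 1` if the real number in row `reg y`, column `reg z` of the input tape is positive,
  and `reg x := 0` otherwise -/
  | test (x y z : ℕ)
  /-- append `reg x` to the output tape -/
  | print (x : ℕ)
  /-- first `c`, then `d` -/
  | seq (c d : Program)
  /-- if `reg x < reg y` then `c` else `d` -/
  | ifLt (x y : ℕ) (c d : Program)
  /-- while `reg x < reg y` do `c` -/
  | whileLt (x y : ℕ) (c : Program)

namespace Memory

/-- Assignment to a register. -/
def setReg (s : Memory) (x v : ℕ) : Memory := { s with reg := Function.update s.reg x v }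

/-- Assignment to a cell of an array. -/
def setArr (s : Memory) (k p v : ℕ) : Memory :=
  { s with arr := Function.update s.arr k (Function.update (s.arr k) p v) }

end Memory

open Classical in
/-- `Exec T c s t s'`: with the input tape `T`, the program `c` started in the memory `s` halts after
exactly `t` steps in the memory `s'`. -/
inductive Exec (T : ℕ → ℕ → ℝ) : Program → Memory → ℕ → Memory → Prop
  | skip (s : Memory) : Exec T .skip s 1 s
  | const (s : Memory) (x k : ℕ) : Exec T (.const x k) s 1 (s.setReg x k)
  | copy (s : Memory) (x y : ℕ) : Exec T (.copy x y) s 1 (s.setReg x (s.reg y))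
  | inc (s : Memory) (x : ℕ) : Exec T (.inc x) s 1 (s.setReg x (s.reg x + 1))
  | dec (s : Memory) (x : ℕ) : Exec T (.dec x) s 1 (s.setReg x (s.reg x - 1))
  | load (s : Memory) (x k y : ℕ) : Exec T (.load x k y) s 1 (s.setReg x (s.arr k (s.reg y)))
  | store (s : Memory) (k x y : ℕ) :
      Exec T (.store k x y) s 1 (s.setArr k (s.reg x) (s.reg y))
  | test (s : Memory) (x y z : ℕ) :
      Exec T (.test x y z) s 1 (s.setReg x (if 0 < T (s.reg y) (s.reg z) then 1 else 0))
  | print (s : Memory) (x : ℕ) : Exec T (.print x) s 1 { s with out := s.out ++ [s.reg x] }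
  | seq {c d : Program} {s s' s'' : Memory} {t t' : ℕ}
      (hc : Exec T c s t s') (hd : Exec T d s' t' s'') : Exec T (.seq c d) s (t + t') s''
  | ifTrue {x y : ℕ} {c d : Program} {s s' : Memory} {t : ℕ} (h : s.reg x < s.reg y)
      (hc : Exec T c s t s') : Exec T (.ifLt x y c d) s (t + 1) s'
  | ifFalse {x y : ℕ} {c d : Program} {s s' : Memory} {t : ℕ} (h : ¬ s.reg x < s.reg y)
      (hd : Exec T d s t s') : Exec T (.ifLt x y c d) s (t + 1) s'
  | whileFalse {x y : ℕ} {c : Program} {s : Memory} (h : ¬ s.reg x < s.reg y) :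
      Exec T (.whileLt x y c) s 1 s
  | whileTrue {x y : ℕ} {c : Program} {s s' s'' : Memory} {t t' : ℕ} (h : s.reg x < s.reg y)
      (hc : Exec T c s t s') (hw : Exec T (.whileLt x y c) s' t' s'') :
      Exec T (.whileLt x y c) s (t + t' + 1) s''

/-! ### Input and output of the machine -/

section Encoding

variable {n : ℕ}

/-- The initial memory: register `0` holds `n`, the arrays `0`, `1` and `2` hold the numbers `|A_i|`,
the numbers `|B_i|` and the characteristic vector of `I`; everything else is zero or empty. -/
def initialMemory (G : Game n) (I : Finset (Fin n)) : Memory where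
  reg := fun x => if x = 0 then n else 0
  arr := fun k p =>
    if h : p < n then
      if k = 0 then G.numA ⟨p, h⟩
      else if k = 1 then G.numB ⟨p, h⟩
      else if k = 2 then (if (⟨p, h⟩ : Fin n) ∈ I then 1 else 0)
      else 0
    else 0
  out := []

/-- The position of the triple `(i, a, b)` in the lexicographic order, counted from `0`. -/
def tripleIndex (G : Game n) (i : Fin n) (a : Fin (G.numA i)) (b : Fin (G.numB i)) : ℕ :=
  ∑ i' ∈ Finset.Iio i, G.numA i' * G.numB i' + (a * G.numB i + b)

/-- The input tape holds the `m₂ × n` matrix whose rows are the `P_i^{ab}` in lexicographic order;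
nothing is said about the other cells. -/
def HoldsTransitions (T : ℕ → ℕ → ℝ) (G : Game n) : Prop :=
  ∀ i a b (j : Fin n), T (tripleIndex G i a b) j = G.P i a b j

/-- The characteristic vector of `S`, followed by those of the `A_i`, for `i = 0, …, n-1`. -/
def LoopState.code {G : Game n} (σ : LoopState G) : List ℕ :=
  ((List.finRange n).map fun i => if i ∈ σ.S then 1 else 0) ++
    (List.finRange n).flatMap fun i =>
      (List.finRange (G.numA i)).map fun a => if a ∈ σ.A i then 1 else 0

/-- The transcript of a run of the algorithm: the successive values of its variables, then the
returned truth value. -/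
def transcript {G : Game n} (l : List (LoopState G)) (ans : Bool) : List ℕ :=
  l.flatMap LoopState.code ++ [if ans then 1 else 0]

end Encoding

end ShapleyGame

namespace ShapleyGame

/-! ### Finite minima and maxima -/

section FiniteMinMax

variable {α β : Type*} [Finite α] [Finite β]

/-! Correctness. The expectation of a nonnegative vector is positive exactly when the support of the
transition meets the support of the vector (`Game.mean_pos_iff`), so every test of the algorithm is
combinatorial. The complement of `Φ(I)` is the least superset of `I` closed under `minMeets`, and
the complement of `Φ*(Φ(I))` is the least closed superset of `Φ(I)` and the discarded states under
`maxMeets` (`mem_Phi_iff`, `mem_clo_iff`).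

After subtraction of its minimum, the fixed point sought is a `u ≥ 0` with support `S ∖ I`. If MIN
can stay in `I`, the multiples of `1_{S∖I}` are supersolutions, and a Knaster–Tarski argument
(`SubFixed.exists_fixed`) shows that a mere subsolution with support `S ∖ I` suffices. The first
test is necessary: the equation for `u`, read on supports, gives the condition on `F⁺`, and the
states where `u` is maximal form a member of `𝓕⁺` disjoint from `I`.

Let `K = Φ*(Φ(I))`. Once the first test is passed, `F` has such a fixed point if and only if `F^△`
has one on `K` (`hasFixed_reduce_iff`). In one direction, the restriction of `u` to `K` is a
subsolution for `F^△`. In the other, let `v` be a solution on `K`, extended by zero. Some fixed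
point `y` of `F` between `1_{Φ(I)}` and `1_{S∖K}` is positive exactly on `S ∖ K`, and `y + εv` is a
subsolution for small `ε`: in a state of `K`, an action of MIN that may leave `K` has a reply under
which `y` has expectation at least a fixed `δ > 0`, and all other actions belong to `F^△`. If `K =
I`, then `v = 0` will do. Each reduction discards the nonempty set `Φ(I)`, whence at most `n`
iterations.

Running time. A closure handles each state at most once; handling it means one scan of its column of
the transition matrix and one reassessment of all actions, both in `O(m₂)`. So an iteration costs
`O(n m₂)`. The program is verified by time-bounded Hoare triples (`Runs`), and a syntactic frame
rule (`Exec.frame`) takes care of everything a command does not touch. -/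

theorem le_iInf_iSup_iff [Nonempty α] [Nonempty β] {f : α → β → ℝ} {c : ℝ} :
    c ≤ ⨅ a, ⨆ b, f a b ↔ ∀ a, ∃ b, c ≤ f a b := by
  constructor
  · intro h a
    obtain ⟨b, hb⟩ := exists_eq_ciSup_of_finite (f := f a)
    exact ⟨b, hb ▸ h.trans (ciInf_le (Set.finite_range _).bddBelow a)⟩
  · intro h
    refine le_ciInf fun a => ?_
    obtain ⟨b, hb⟩ := h a
    exact hb.trans (le_ciSup (Set.finite_range _).bddAbove b)

theorem iInf_iSup_le_iff [Nonempty α] [Nonempty β] {f : α → β → ℝ} {c : ℝ} :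
    ⨅ a, ⨆ b, f a b ≤ c ↔ ∃ a, ∀ b, f a b ≤ c := by
  constructor
  · intro h
    obtain ⟨a, ha⟩ := exists_eq_ciInf_of_finite (f := fun a => ⨆ b, f a b)
    exact ⟨a, fun b => (le_ciSup (Set.finite_range (f a)).bddAbove b).trans (ha.trans_le h)⟩
  · rintro ⟨a, ha⟩
    exact (ciInf_le (Set.finite_range _).bddBelow a).trans (ciSup_le ha)

theorem exists_pos_le_of_pos (f : α → ℝ) : ∃ δ > 0, ∀ x, 0 < f x → δ ≤ f x := by
  by_cases h : Nonempty {x // 0 < f x}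
  · obtain ⟨x, hx⟩ := Finite.exists_min fun x : {x // 0 < f x} => f x
    exact ⟨f x, x.2, fun y hy => hx ⟨y, hy⟩⟩
  · exact ⟨1, one_pos, fun x hx => (h ⟨⟨x, hx⟩⟩).elim⟩

end FiniteMinMax

/-! ### Expectations and supports of transitions -/

namespace Game

variable {n : ℕ} (G : Game n)

/-- The expectation of `x` after the actions `a` and `b` in state `i`. -/
def mean (i : Fin n) (a : Fin (G.numA i)) (b : Fin (G.numB i)) (x : Fin n → ℝ) : ℝ :=
  ∑ j, G.P i a b j * x j

/-- The actions `a` and `b` in state `i` lead to `D` with positive probability. -/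
def Hits (D : Set (Fin n)) (i : Fin n) (a : Fin (G.numA i)) (b : Fin (G.numB i)) : Prop :=
  ∃ j ∈ D, 0 < G.P i a b j

variable {G} {i : Fin n} {a : Fin (G.numA i)} {b : Fin (G.numB i)} {x y : Fin n → ℝ}
  {D E : Set (Fin n)} {c : ℝ}

instance : NeZero (G.numA i) := ⟨(G.numA_pos i).ne'⟩

instance : NeZero (G.numB i) := ⟨(G.numB_pos i).ne'⟩

theorem eq_zero_of_not_hits (h : ¬ G.Hits D i a b) {j : Fin n} (hj : j ∈ D) : G.P i a b j = 0 :=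
  le_antisymm (not_lt.1 fun h' => h ⟨j, hj, h'⟩) (G.P_nonneg i a b j)

theorem Hits.mono (h : G.Hits D i a b) (hDE : D ⊆ E) : G.Hits E i a b :=
  let ⟨j, hj, hp⟩ := h
  ⟨j, hDE hj, hp⟩

theorem exists_P_pos (i : Fin n) (a : Fin (G.numA i)) (b : Fin (G.numB i)) :
    ∃ j, 0 < G.P i a b j := by
  by_contra! h
  have := Finset.sum_nonpos fun j (_ : j ∈ Finset.univ) => h j
  rw [G.P_sum] at this
  linarith

theorem hits_of_not_hits_compl (h : ¬ G.Hits Dᶜ i a b) : G.Hits D i a b := by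
  obtain ⟨j, hj⟩ := exists_P_pos i a b
  by_contra h'
  by_cases hD : j ∈ D
  · exact h' ⟨j, hD, hj⟩
  · exact h ⟨j, hD, hj⟩

theorem mean_mono (h : x ≤ y) : G.mean i a b x ≤ G.mean i a b y :=
  Finset.sum_le_sum fun j _ => mul_le_mul_of_nonneg_left (h j) (G.P_nonneg i a b j)

theorem mean_const : G.mean i a b (fun _ => c) = c := by
  simp [mean, ← Finset.sum_mul, G.P_sum]

theorem mean_sub_const : G.mean i a b (fun j => x j - c) = G.mean i a b x - c := by
  simp [mean, mul_sub, Finset.sum_sub_distrib, ← Finset.sum_mul, G.P_sum]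

theorem mean_congr (h : ∀ j, 0 < G.P i a b j → x j = y j) : G.mean i a b x = G.mean i a b y := by
  refine Finset.sum_congr rfl fun j _ => ?_
  rcases (G.P_nonneg i a b j).eq_or_lt with h' | h'
  · simp [← h']
  · rw [h j h']

theorem mean_le (h : ∀ j, x j ≤ c) : G.mean i a b x ≤ c :=
  (mean_mono h).trans_eq (mean_const (c := c))

theorem mean_nonneg (h : 0 ≤ x) : 0 ≤ G.mean i a b x :=
  Finset.sum_nonneg fun j _ => mul_nonneg (G.P_nonneg i a b j) (h j)

theorem mean_pos_iff (h : 0 ≤ x) : 0 < G.mean i a b x ↔ G.Hits {j | 0 < x j} i a b := by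
  unfold mean
  rw [Finset.sum_pos_iff_of_nonneg fun j _ => mul_nonneg (G.P_nonneg i a b j) (h j)]
  constructor
  · rintro ⟨j, -, hj⟩
    exact ⟨j, pos_of_mul_pos_right hj (G.P_nonneg i a b j), pos_of_mul_pos_left hj (h j)⟩
  · rintro ⟨j, hj, hp⟩
    exact ⟨j, Finset.mem_univ _, mul_pos hp hj⟩

/-- Maximum principle: an average of numbers at most `c` reaches `c` only if no weight lies on
smaller numbers. -/
theorem not_hits_of_le_mean (h : ∀ j, 0 < G.P i a b j → x j ≤ c) (hc : c ≤ G.mean i a b x) :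
    ¬ G.Hits {j | x j < c} i a b := by
  rintro ⟨j, hj, hp⟩
  refine absurd hc (not_le.2 ?_)
  rw [← mean_const (G := G) (i := i) (a := a) (b := b) (c := c)]
  refine Finset.sum_lt_sum (fun k _ => ?_) ⟨j, Finset.mem_univ _, mul_lt_mul_of_pos_left hj hp⟩
  rcases (G.P_nonneg i a b k).eq_or_lt with h' | h'
  · simp [← h']
  · exact mul_le_mul_of_nonneg_left (h k h') h'.le

end Game

/-! ### Closed sets and the combinatorial form of the tests -/

/-- The least superset of `D` which is closed under `f`. -/
def leastClosed {α : Type*} (f : Set α → Set α) (D : Set α) : Set α := ⋂₀ {R | D ⊆ R ∧ f R ⊆ R}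

section LeastClosed

variable {α : Type*} {f : Set α → Set α} {D R : Set α}

theorem subset_leastClosed : D ⊆ leastClosed f D := Set.subset_sInter fun _ h => h.1

theorem leastClosed_subset (h : D ⊆ R) (h' : f R ⊆ R) : leastClosed f D ⊆ R :=
  Set.sInter_subset_of_mem ⟨h, h'⟩

theorem map_leastClosed_subset (hf : Monotone f) : f (leastClosed f D) ⊆ leastClosed f D :=
  Set.subset_sInter fun _ h => (hf (Set.sInter_subset_of_mem h)).trans h.2

theorem leastClosed_eq (hf : Monotone f) : leastClosed f D = D ∪ f (leastClosed f D) := by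
  refine subset_antisymm (leastClosed_subset Set.subset_union_left ?_)
    (Set.union_subset subset_leastClosed (map_leastClosed_subset hf))
  exact (hf (Set.union_subset subset_leastClosed (map_leastClosed_subset hf))).trans
    Set.subset_union_right

end LeastClosed

namespace LoopState

variable {n : ℕ} {G : Game n} (σ : LoopState G)

/-- The states where some action of MIN makes every action of MAX lead to `D` with positive
probability. -/
def minMeets (D : Set (Fin n)) : Set (Fin n) := {i | ∃ a ∈ σ.A i, ∀ b, G.Hits D i a b}

/-- The states where every action of MIN has a reply of MAX that leads to `D` with positive
probability. -/
def maxMeets (D : Set (Fin n)) : Set (Fin n) := {i | ∀ a ∈ σ.A i, ∃ b, G.Hits D i a b}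

theorem minMeets_mono : Monotone σ.minMeets :=
  fun _ _ h _ ⟨a, ha, h'⟩ => ⟨a, ha, fun b => (h' b).mono h⟩

theorem maxMeets_mono : Monotone σ.maxMeets :=
  fun _ _ h _ h' a ha => let ⟨b, hb⟩ := h' a ha; ⟨b, hb.mono h⟩

/-- The complement of `Φ(I)`. -/
def outer (I : Finset (Fin n)) : Set (Fin n) := leastClosed σ.minMeets I

/-- The complement of `Φ*(Φ(I))`. -/
def escape (I : Finset (Fin n)) : Set (Fin n) := leastClosed σ.maxMeets (σ.outer I)ᶜ

/-- The variables describe a game: every current state has an action and the current actions never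
leave the current state space. -/
structure Valid : Prop where
  nonempty : ∀ i ∈ σ.S, (σ.A i).Nonempty
  mem_S : ∀ i, ∀ a ∈ σ.A i, i ∈ σ.S
  eq_zero : ∀ i, ∀ a ∈ σ.A i, ∀ b, ∀ j ∉ σ.S, G.P i a b j = 0

variable {σ} {I : Finset (Fin n)}

theorem valid_full : (full G).Valid where
  nonempty _ _ := Finset.univ_nonempty
  mem_S _ _ _ := Finset.mem_univ _
  eq_zero _ _ _ _ _ h := (h (Finset.mem_univ _)).elim

namespace Valid

theorem mem_S_of_pos (hσ : σ.Valid) {i : Fin n} {a : Fin (G.numA i)} (ha : a ∈ σ.A i)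
    {b : Fin (G.numB i)} {j : Fin n} (h : 0 < G.P i a b j) : j ∈ σ.S := by
  by_contra hj
  exact h.ne' (hσ.eq_zero i a ha b j hj)

/-- Discarded states have no actions, so the condition is vacuous there. This is why `escape`
automatically contains them, whereas `outer` stays inside the current state space. -/
theorem compl_subset_maxMeets (hσ : σ.Valid) (D : Set (Fin n)) :
    (↑σ.S : Set (Fin n))ᶜ ⊆ σ.maxMeets D :=
  fun i hi a ha => (hi (hσ.mem_S i a ha)).elim

theorem minMeets_subset (hσ : σ.Valid) (D : Set (Fin n)) : σ.minMeets D ⊆ σ.S :=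
  fun i ⟨a, ha, _⟩ => hσ.mem_S i a ha

theorem sum_P (hσ : σ.Valid) (i : σ.S) (a : σ.A i) (b : Fin (G.numB i)) (x : Fin n → ℝ) :
    ∑ j : σ.S, σ.P i a b j * x j = G.mean i a b x := by
  refine (Finset.sum_coe_sort σ.S fun j => G.P i a b j * x j).trans ?_
  refine Finset.sum_subset (Finset.subset_univ _) fun j _ hj => ?_
  rw [hσ.eq_zero i a a.2 b j hj, zero_mul]

theorem le_shapley_iff (hσ : σ.Valid) {x : Fin n → ℝ} {i : σ.S} {c : ℝ} :
    c ≤ shapley σ.P (fun j => x j) i ↔ ∀ a ∈ σ.A i, ∃ b, c ≤ G.mean i a b x := by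
  have : Nonempty (σ.A i) := (hσ.nonempty i i.2).to_subtype
  simp only [shapley, hσ.sum_P]
  rw [le_iInf_iSup_iff]
  simp

theorem shapley_le_iff (hσ : σ.Valid) {x : Fin n → ℝ} {i : σ.S} {c : ℝ} :
    shapley σ.P (fun j => x j) i ≤ c ↔ ∃ a ∈ σ.A i, ∀ b, G.mean i a b x ≤ c := by
  have : Nonempty (σ.A i) := (hσ.nonempty i i.2).to_subtype
  simp only [shapley, hσ.sum_P]
  rw [iInf_iSup_le_iff]
  simp

end Valid

theorem ind_eq (K : Set σ.S) :
    ind K = fun j : σ.S => ind (S := Fin n) (Subtype.val '' K) j := by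
  classical
  ext j
  simp [ind, Set.indicator_apply]

theorem ind_nonneg {S : Type*} (K : Set S) : 0 ≤ ind K :=
  fun _ => Set.indicator_nonneg (fun _ _ => zero_le_one) _

theorem ind_pos_iff {S : Type*} {K : Set S} {i : S} : 0 < ind K i ↔ i ∈ K := by
  classical
  by_cases h : i ∈ K <;> simp [ind, h]

theorem ind_lt_one_iff {S : Type*} {K : Set S} {i : S} : ind K i < 1 ↔ i ∉ K := by
  classical
  by_cases h : i ∈ K <;> simp [ind, h]

theorem ind_le_one {S : Type*} (K : Set S) (i : S) : ind K i ≤ 1 := by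
  classical
  by_cases h : i ∈ K <;> simp [ind, h]

namespace Valid

/-- On `J` the inequality asks that MAX can always keep the whole probability in `J`; off `J` it
holds because expectations of indicators are nonnegative. The complement may be taken among all
states, since valid actions put no mass outside `S`. -/
theorem mem_upperFamily_iff (hσ : σ.Valid) {J : Set σ.S} :
    J ∈ upperFamily σ.P ↔
      ∀ i ∈ J, ∀ a ∈ σ.A i, ∃ b, ¬ G.Hits (Subtype.val '' J)ᶜ i a b := by
  have key : ∀ (i : σ.S), i ∈ J → (ind J i ≤ shapley σ.P (ind J) i ↔
      ∀ a ∈ σ.A i, ∃ b, ¬ G.Hits (Subtype.val '' J)ᶜ i a b) := by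
    intro i hi
    have h1 : ind J i = 1 := by simp [ind, hi]
    rw [h1, ind_eq, hσ.le_shapley_iff]
    refine forall₂_congr fun a ha => exists_congr fun b => ?_
    constructor
    · intro h hh
      refine Game.not_hits_of_le_mean (fun j _ => ind_le_one _ j) h (hh.mono fun j hj => ?_)
      exact ind_lt_one_iff.2 hj
    · intro h
      rw [Game.mean_congr (y := fun _ => 1), Game.mean_const]
      intro j hj
      by_contra hne
      exact h ⟨j, fun hj' => hne (by simp only [ind]; rw [Set.indicator_of_mem hj']), hj⟩
  constructor
  · exact fun h i hi => (key i hi).1 (h i)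
  · intro h i
    by_cases hi : i ∈ J
    · exact (key i hi).2 (h i hi)
    · have h1 : ind J i = 0 := by simp [ind, hi]
      rw [h1, ind_eq, hσ.le_shapley_iff]
      exact fun a _ => ⟨0, Game.mean_nonneg (ind_nonneg _)⟩

theorem mem_lowerFamily_iff (hσ : σ.Valid) {J : Set σ.S} :
    J ∈ lowerFamily σ.P ↔
      ∀ i ∈ J, ∃ a ∈ σ.A i, ∀ b, ¬ G.Hits (Subtype.val '' Jᶜ) i a b := by
  have key : ∀ (i : σ.S), i ∈ J → (shapley σ.P (ind Jᶜ) i ≤ ind Jᶜ i ↔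
      ∃ a ∈ σ.A i, ∀ b, ¬ G.Hits (Subtype.val '' Jᶜ) i a b) := by
    intro i hi
    have h1 : ind Jᶜ i = 0 := by simp [ind, hi]
    rw [h1, ind_eq, hσ.shapley_le_iff]
    refine exists_congr fun a => and_congr_right fun _ => forall_congr' fun b => ?_
    rw [← not_lt, Game.mean_pos_iff (ind_nonneg _)]
    simp only [ind_pos_iff, Set.ofPred_mem_eq]
  constructor
  · exact fun h i hi => (key i hi).1 (h i)
  · intro h i
    by_cases hi : i ∈ J
    · exact (key i hi).2 (h i hi)
    · have h1 : ind Jᶜ i = 1 := by simp [ind, hi]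
      rw [h1, ind_eq, hσ.shapley_le_iff]
      obtain ⟨a, ha⟩ := hσ.nonempty i i.2
      exact ⟨a, ha, fun b => Game.mean_le (ind_le_one _)⟩

/-- The complement of a member of `𝓕⁺` disjoint from `I` contains `I` and is closed under
`minMeets`, so it contains `outer`. Conversely, what lies outside `outer` is itself such a member,
hence the largest one. -/
theorem mem_Phi_iff (hσ : σ.Valid) {i : σ.S} :
    i ∈ Phi σ.P (σ.sub I) ↔ (i : Fin n) ∉ σ.outer I := by
  constructor
  · rintro ⟨J, ⟨hJ, hd⟩, hi⟩ h
    rw [hσ.mem_upperFamily_iff] at hJ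
    refine leastClosed_subset (R := (Subtype.val '' J)ᶜ) ?_ ?_ h ⟨i, hi, rfl⟩
    · rintro j hj ⟨k, hk, rfl⟩
      exact Set.eq_empty_iff_forall_notMem.1 hd k ⟨hj, hk⟩
    · rintro j ⟨a, ha, hh⟩ ⟨k, hk, rfl⟩
      obtain ⟨b, hb⟩ := hJ k hk a ha
      exact hb (hh b)
  · intro h
    refine ⟨{j | (j : Fin n) ∉ σ.outer I}, ⟨?_, ?_⟩, h⟩
    · rw [hσ.mem_upperFamily_iff]
      intro j hj a ha
      by_contra! hh
      refine hj (map_leastClosed_subset σ.minMeets_mono ⟨a, ha, fun b => ?_⟩)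
      obtain ⟨k, hk, hp⟩ := hh b
      refine ⟨k, ?_, hp⟩
      by_contra hk'
      exact hk ⟨⟨k, hσ.mem_S_of_pos ha hp⟩, hk', rfl⟩
    · rw [Set.eq_empty_iff_forall_notMem]
      exact fun j hj => hj.2 (subset_leastClosed hj.1)

/-- Same duality as for `Φ`, with the players exchanged: outside `escape` MIN has an action that
avoids `escape` for sure. -/
theorem mem_clo_iff (hσ : σ.Valid) {i : σ.S} : i ∈ σ.clo I ↔ (i : Fin n) ∉ σ.escape I := by
  constructor
  · rintro ⟨J, ⟨hJ, hd⟩, hi⟩ h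
    rw [hσ.mem_lowerFamily_iff] at hJ
    refine leastClosed_subset (R := (Subtype.val '' J)ᶜ) ?_ ?_ h ⟨i, hi, rfl⟩
    · rintro j hj ⟨k, hk, rfl⟩
      exact Set.eq_empty_iff_forall_notMem.1 hd k ⟨hk, hσ.mem_Phi_iff.2 hj⟩
    · rintro j hh ⟨k, hk, rfl⟩
      obtain ⟨a, ha, hb⟩ := hJ k hk
      obtain ⟨b, j, hj, hp⟩ := hh a ha
      exact hb b ⟨j, ⟨⟨j, hσ.mem_S_of_pos ha hp⟩, fun h => hj ⟨_, h, rfl⟩, rfl⟩, hp⟩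
  · intro h
    refine ⟨{j | (j : Fin n) ∉ σ.escape I}, ⟨?_, ?_⟩, h⟩
    · rw [hσ.mem_lowerFamily_iff]
      intro j hj
      by_contra! hh
      refine hj (map_leastClosed_subset σ.maxMeets_mono fun a ha => ?_)
      obtain ⟨b, k, ⟨k, hk, rfl⟩, hp⟩ := hh a ha
      exact ⟨b, k, not_not.1 hk, hp⟩
    · rw [Set.eq_empty_iff_forall_notMem]
      exact fun j hj => hj.1 (subset_leastClosed (hσ.mem_Phi_iff.1 hj.2))

theorem upperAbstraction_eq_iff (hσ : σ.Valid) :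
    upperAbstraction σ.P (ind (σ.sub I)ᶜ) = ind (σ.sub I)ᶜ ↔
      ∀ i ∈ σ.S, i ∈ σ.maxMeets (↑I)ᶜ ↔ i ∉ I := by
  have hne : ∀ (i : σ.S) (a : σ.A i) (b : Fin (G.numB i)), Nonempty {j // 0 < σ.P i a b j} := by
    intro i a b
    obtain ⟨j, hj⟩ := Game.exists_P_pos (i : Fin n) a.1 b
    exact ⟨⟨⟨j, hσ.mem_S_of_pos a.2 hj⟩, hj⟩⟩
  -- The image of a 0-1 vector is again a 0-1 vector: a level `c > 0` is reached exactly on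
  -- `maxMeets`, and only if `c ≤ 1`.
  have h01 : ∀ (i : σ.S) (c : ℝ), 0 < c → (c ≤ upperAbstraction σ.P (ind (σ.sub I)ᶜ) i ↔
      (c ≤ 1 ∧ (i : Fin n) ∈ σ.maxMeets (↑I)ᶜ)) := by
    intro i c hc
    have : Nonempty (σ.A i) := (hσ.nonempty i i.2).to_subtype
    simp only [upperAbstraction]
    rw [le_iInf_iSup_iff]
    constructor
    · intro h
      have h' : ∀ a : σ.A i, ∃ b, ∃ j : {j // 0 < σ.P i a b j}, c ≤ ind (σ.sub I)ᶜ (j : σ.S) := by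
        intro a
        obtain ⟨b, hb⟩ := h a
        have := hne i a b
        obtain ⟨j, hj⟩ := exists_eq_ciSup_of_finite
          (f := fun j : {j // 0 < σ.P i a b j} => ind (σ.sub I)ᶜ (j : σ.S))
        exact ⟨b, j, hb.trans_eq hj.symm⟩
      constructor
      · obtain ⟨b, j, hj⟩ := h' (Classical.arbitrary _)
        exact hj.trans (ind_le_one _ _)
      · intro a ha
        obtain ⟨b, j, hj⟩ := h' ⟨a, ha⟩
        exact ⟨b, j, ind_pos_iff.1 (hc.trans_le hj), j.2⟩
    · rintro ⟨hc1, h⟩ a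
      obtain ⟨b, j, hj, hp⟩ := h a a.2
      refine ⟨b, hc1.trans ?_⟩
      have hj' : (⟨j, hσ.mem_S_of_pos a.2 hp⟩ : σ.S) ∈ (σ.sub I)ᶜ := hj
      refine le_trans ?_ (le_ciSup (f := fun j : {j // 0 < σ.P i a b j} => ind (σ.sub I)ᶜ (j : σ.S))
        (Set.finite_range _).bddAbove ⟨⟨j, hσ.mem_S_of_pos a.2 hp⟩, hp⟩)
      simp only [ind]
      rw [Set.indicator_of_mem hj']
  have hnn : ∀ i, 0 ≤ upperAbstraction σ.P (ind (σ.sub I)ᶜ) i := fun i =>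
    Real.iInf_nonneg fun a => Real.iSup_nonneg fun b => Real.iSup_nonneg fun j => ind_nonneg _ _
  constructor
  · intro h i hi
    have := h01 ⟨i, hi⟩ 1 one_pos
    rw [h, and_iff_right le_rfl] at this
    rw [← this, ← not_lt, ind_lt_one_iff, not_not]
    rfl
  · intro h
    ext i
    refine eq_of_forall_le_iff fun c => ?_
    rcases le_or_gt c 0 with hc | hc
    · exact iff_of_true (hc.trans (hnn i)) (hc.trans (ind_nonneg _ _))
    · rw [h01 i c hc, h i i.2]
      by_cases hi : (i : Fin n) ∈ I
      · have : i ∉ (σ.sub I)ᶜ := fun h => h hi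
        simp [ind, this, hi, hc]
      · have : i ∈ (σ.sub I)ᶜ := hi
        simp [ind, this, hi]

theorem rejects_iff (hσ : σ.Valid) :
    σ.Rejects I ↔ ¬ (∀ i ∈ σ.S, i ∈ σ.maxMeets (↑I)ᶜ ↔ i ∉ I) ∨ ↑σ.S ⊆ σ.outer I := by
  refine or_congr (not_congr hσ.upperAbstraction_eq_iff) ?_
  rw [Set.eq_empty_iff_forall_notMem]
  simp only [hσ.mem_Phi_iff, not_not]
  exact ⟨fun h i hi => h ⟨i, hi⟩, fun h i => h i.2⟩

theorem compl_S_subset_escape (hσ : σ.Valid) : (↑σ.S : Set (Fin n))ᶜ ⊆ σ.escape I :=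
  (hσ.compl_subset_maxMeets _).trans (map_leastClosed_subset σ.maxMeets_mono)

theorem clo_eq_iff (hσ : σ.Valid) (hI : I ⊆ σ.S) :
    σ.clo I = σ.sub I ↔ ∀ i, i ∈ I ↔ i ∉ σ.escape I := by
  constructor
  · intro h i
    by_cases hi : i ∈ σ.S
    · rw [← hσ.mem_clo_iff (i := ⟨i, hi⟩), h]
      rfl
    · exact iff_of_false (fun h' => hi (hI h')) (not_not.2 (hσ.compl_S_subset_escape hi))
  · intro h
    ext i
    rw [hσ.mem_clo_iff, ← h]
    rfl

theorem mem_reduce_S (hσ : σ.Valid) {i : Fin n} : i ∈ (σ.reduce I).S ↔ i ∉ σ.escape I := by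
  simp only [reduce, Finset.mem_filter, Finset.mem_univ, true_and, hσ.mem_clo_iff]
  refine ⟨fun ⟨_, h⟩ => h, fun h => ⟨?_, h⟩⟩
  by_contra hi
  exact h (hσ.compl_S_subset_escape hi)

/-- A state added by the closure is in `maxMeets` by construction. A starting state is outside
`outer`, so each action has a reply that avoids `outer`; the probabilities sum to one, so this reply
hits the complement of `outer`, a part of `escape`. -/
theorem escape_subset_maxMeets : σ.escape I ⊆ σ.maxMeets (σ.escape I) := by
  intro i hi a ha
  have h := leastClosed_eq (D := (σ.outer I)ᶜ) σ.maxMeets_mono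
  rw [← escape] at h
  rw [h] at hi
  rcases hi with hi | hi
  · by_contra! hh
    refine hi (map_leastClosed_subset σ.minMeets_mono ⟨a, ha, fun b => ?_⟩)
    refine Game.hits_of_not_hits_compl fun h' => hh b (h'.mono subset_leastClosed)
  · exact hi a ha

/-- No condition on `i` is needed: in a state of `escape` every action has a reply into `escape`, so
all its actions disappear by themselves. -/
theorem mem_reduce_A (hσ : σ.Valid) {i : Fin n} {a : Fin (G.numA i)} :
    a ∈ (σ.reduce I).A i ↔ a ∈ σ.A i ∧ ∀ b, ¬ G.Hits (σ.escape I) i a b := by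
  simp only [reduce, Finset.mem_filter, Finset.mem_univ, true_and, hσ.mem_clo_iff]
  constructor
  · rintro ⟨hi, ha, h, hf⟩
    refine ⟨ha, fun b ⟨j, hj, hp⟩ => ?_⟩
    have hjS := hσ.mem_S_of_pos ha hp
    have := hf b ⟨j, hjS⟩ (fun h' => hσ.mem_clo_iff.1 h' hj)
    exact hp.ne' this
  · rintro ⟨ha, hb⟩
    refine ⟨hσ.mem_S i a ha, ha, fun h => ?_, fun b j hj => ?_⟩
    · obtain ⟨b, hb'⟩ := escape_subset_maxMeets h a ha
      exact hb b hb'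
    · rw [hσ.mem_clo_iff, not_not] at hj
      exact Game.eq_zero_of_not_hits (hb b) hj

theorem reduce (hσ : σ.Valid) : (σ.reduce I).Valid where
  nonempty i hi := by
    rw [hσ.mem_reduce_S] at hi
    by_contra h
    refine hi (map_leastClosed_subset σ.maxMeets_mono fun a ha => ?_)
    by_contra! hb
    exact h ⟨a, hσ.mem_reduce_A.2 ⟨ha, hb⟩⟩
  mem_S i a ha := by
    rw [hσ.mem_reduce_A] at ha
    rw [hσ.mem_reduce_S]
    intro h
    obtain ⟨b, hb⟩ := escape_subset_maxMeets h a ha.1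
    exact ha.2 b hb
  eq_zero i a ha b j hj := by
    rw [hσ.mem_reduce_A] at ha
    rw [hσ.mem_reduce_S, not_not] at hj
    exact Game.eq_zero_of_not_hits (ha.2 b) hj

end Valid

/-! ### Sub- and supersolutions, and fixed points with prescribed support -/

/-- On the current state space, `x ≤ F(x)` for the current operator `F`. -/
def SubFixed (σ : LoopState G) (x : Fin n → ℝ) : Prop :=
  ∀ i ∈ σ.S, ∀ a ∈ σ.A i, ∃ b, x i ≤ G.mean i a b x

/-- On the current state space, `F(x) ≤ x` for the current operator `F`. -/
def SuperFixed (σ : LoopState G) (x : Fin n → ℝ) : Prop :=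
  ∀ i ∈ σ.S, ∃ a ∈ σ.A i, ∀ b, G.mean i a b x ≤ x i

/-- Knaster–Tarski for the monotone operator `F`: the pointwise supremum of the subsolutions between
`w` and `z` is a fixed point. It is done by hand because `F` acts only on the coordinates in `S`,
the others being free. -/
theorem SubFixed.exists_fixed {w z : Fin n → ℝ} (hw : σ.SubFixed w) (hz : σ.SuperFixed z)
    (hwz : w ≤ z) : ∃ u, w ≤ u ∧ u ≤ z ∧ σ.SubFixed u ∧ σ.SuperFixed u := by
  classical
  set X : Set (Fin n → ℝ) := {x | w ≤ x ∧ x ≤ z ∧ σ.SubFixed x} with hX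
  have hne : X.Nonempty := ⟨w, le_rfl, hwz, hw⟩
  have : Nonempty X := hne.to_subtype
  set u : Fin n → ℝ := fun i => ⨆ x : X, x.1 i with hu
  have hbdd : ∀ i, BddAbove (Set.range fun x : X => x.1 i) := fun i =>
    ⟨z i, by rintro _ ⟨x, rfl⟩; exact x.2.2.1 i⟩
  have hle : ∀ x ∈ X, x ≤ u := fun x hx i => le_ciSup (hbdd i) ⟨x, hx⟩
  have hwu : w ≤ u := hle w ⟨le_rfl, hwz, hw⟩
  have huz : u ≤ z := fun i => ciSup_le fun x => x.2.2.1 i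
  have hsub : σ.SubFixed u := by
    intro i hi a ha
    obtain ⟨b, hb⟩ := Finite.exists_max fun b => G.mean i a b u
    refine ⟨b, ciSup_le fun x => ?_⟩
    obtain ⟨b', hb'⟩ := x.2.2.2 i hi a ha
    exact hb'.trans ((Game.mean_mono (hle x x.2)).trans (hb b'))
  refine ⟨u, hwu, huz, hsub, fun i hi => ?_⟩
  by_contra! hlt
  choose! b hb using hlt
  obtain ⟨a₀, ha₀, hz₀⟩ := hz i hi
  obtain ⟨a, ha, hmin⟩ := Finset.exists_min_image (σ.A i) (fun a => G.mean i a (b a) u) ⟨a₀, ha₀⟩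
  -- If `u i < F(u) i`, then `c` is a level above `u i` that MAX can guarantee against every action.
  -- Raising `u i` to `c` gives a larger subsolution, still below `z`, against the choice of `u`.
  set c := G.mean i a (b a) u
  have hux : u ≤ Function.update u i c := by
    intro j
    by_cases hj : j = i
    · subst hj
      simpa using (hb a ha).le
    · simp [hj]
  have hmem : Function.update u i c ∈ X := by
    refine ⟨hwu.trans hux, fun j => ?_, fun j hj a' ha' => ?_⟩
    · by_cases hj : j = i
      · subst hj
        simpa using (hmin a₀ ha₀).trans ((Game.mean_mono huz).trans (hz₀ _))
      · simpa [hj] using huz j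
    · by_cases hji : j = i
      · subst hji
        exact ⟨b a', by simpa using (hmin a' ha').trans (Game.mean_mono hux)⟩
      · obtain ⟨b', hb'⟩ := hsub j hj a' ha'
        exact ⟨b', by simpa [hji] using hb'.trans (Game.mean_mono hux)⟩
  have := hle _ hmem i
  simp only [Function.update_self] at this
  exact absurd (hb a ha) (not_lt.2 this)

/-- The current operator has a fixed point with minimum `0`, attained exactly on `I`. -/
def HasFixed (σ : LoopState G) (I : Finset (Fin n)) : Prop :=
  ∃ u : Fin n → ℝ, σ.SubFixed u ∧ σ.SuperFixed u ∧ 0 ≤ u ∧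
    ∀ i, 0 < u i ↔ i ∈ σ.S ∧ i ∉ I

theorem mean_indicator_eq_zero {J : Set (Fin n)} {c : ℝ} (hc : 0 ≤ c) {i : Fin n}
    {a : Fin (G.numA i)} {b : Fin (G.numB i)} (h : ¬ G.Hits J i a b) :
    G.mean i a b (fun j => c * ind J j) = 0 := by
  refine le_antisymm (not_lt.1 fun h' => h ?_)
    (Game.mean_nonneg fun j => mul_nonneg hc (ind_nonneg J j))
  refine ((Game.mean_pos_iff fun j => mul_nonneg hc (ind_nonneg J j)).1 h').mono fun j hj => ?_
  exact ind_pos_iff.1 (pos_of_mul_pos_right hj hc)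

theorem mean_indicator_le {J : Set (Fin n)} {c : ℝ} (hc : 0 ≤ c) {i : Fin n}
    {a : Fin (G.numA i)} {b : Fin (G.numB i)} : G.mean i a b (fun j => c * ind J j) ≤ c :=
  Game.mean_le fun j => mul_le_of_le_one_right hc (ind_le_one J j)

/-- The scaled indicator of `J` is a supersolution if MIN can stay outside `J`. -/
theorem Valid.superFixed_indicator (hσ : σ.Valid) {J : Set (Fin n)}
    (h : ∀ i ∈ σ.S, i ∉ J → i ∉ σ.maxMeets J) {c : ℝ} (hc : 0 ≤ c) :
    σ.SuperFixed fun j => c * ind J j := by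
  classical
  intro i hi
  by_cases hJ : i ∈ J
  · obtain ⟨a, ha⟩ := hσ.nonempty i hi
    refine ⟨a, ha, fun b => (mean_indicator_le hc).trans_eq ?_⟩
    simp [ind, hJ]
  · have := h i hi hJ
    simp only [maxMeets, Set.mem_ofPred_eq] at this
    push Not at this
    obtain ⟨a, ha, hb⟩ := this
    refine ⟨a, ha, fun b => ?_⟩
    rw [mean_indicator_eq_zero hc (hb b)]
    exact mul_nonneg hc (ind_nonneg J i)

/-- Between a subsolution that is positive on `S ∖ I` and zero elsewhere and the indicator of
`S ∖ I` there is a fixed point. -/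
theorem Valid.hasFixed_of_subFixed (hσ : σ.Valid)
    (hI : ∀ i ∈ σ.S, i ∈ I → i ∉ σ.maxMeets (↑I)ᶜ) {w : Fin n → ℝ} (hw : σ.SubFixed w)
    (hw0 : 0 ≤ w) (hpos : ∀ i, 0 < w i ↔ i ∈ σ.S ∧ i ∉ I) : σ.HasFixed I := by
  classical
  -- Any upper bound of all entries of `w` would do.
  set c := ∑ i, w i
  have hc : 0 ≤ c := Finset.sum_nonneg fun i _ => hw0 i
  set J : Set (Fin n) := {i | i ∈ σ.S ∧ i ∉ I}
  have hJ : ∀ i ∈ σ.S, i ∉ J → i ∉ σ.maxMeets J := by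
    intro i hi hiJ h
    refine hI i hi (by_contra fun h' => hiJ ⟨hi, h'⟩) (σ.maxMeets_mono (fun j hj => hj.2) h)
  obtain ⟨u, hwu, huz, h1, h2⟩ := hw.exists_fixed (hσ.superFixed_indicator hJ hc) (fun i => by
    by_cases hi : i ∈ J
    · simpa [ind, hi] using Finset.single_le_sum (fun j _ => hw0 j) (Finset.mem_univ i)
    · have : ¬ 0 < w i := fun h => hi ((hpos i).1 h)
      simpa [ind, hi] using this)
  refine ⟨u, h1, h2, hw0.trans hwu, fun i => ⟨fun h => ?_, fun h => ?_⟩⟩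
  · exact ind_pos_iff.1 (pos_of_mul_pos_right (h.trans_le (huz i)) hc)
  · exact ((hpos i).2 h).trans_le (hwu i)

/-- The fixed-point equation read on supports: where `u` vanishes MIN can avoid the support of `u`,
and where `u` is positive MAX can always hit it. -/
theorem HasFixed.maxMeets_iff (hσ : σ.Valid) (h : σ.HasFixed I) :
    ∀ i ∈ σ.S, i ∈ σ.maxMeets (↑I)ᶜ ↔ i ∉ I := by
  obtain ⟨u, hsub, hsup, h0, hpos⟩ := h
  intro i hi
  constructor
  · intro h hiI
    have hui : u i ≤ 0 := not_lt.1 fun h' => ((hpos i).1 h').2 hiI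
    obtain ⟨a, ha, hb⟩ := hsup i hi
    obtain ⟨b, j, hj, hp⟩ := h a ha
    refine absurd ((hb b).trans hui) (not_le.2 ((Game.mean_pos_iff h0).2 ⟨j, ?_, hp⟩))
    exact (hpos j).2 ⟨hσ.mem_S_of_pos ha hp, hj⟩
  · intro hiI a ha
    obtain ⟨b, hb⟩ := hsub i hi a ha
    have := (Game.mean_pos_iff h0).1 (((hpos i).2 ⟨hi, hiI⟩).trans_le hb)
    exact ⟨b, this.mono fun j hj => ((hpos j).1 hj).2⟩

/-- The set where `u` is below its maximum contains `I`, and the maximum principle makes it closed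
under `minMeets`: at a maximal state each action has a reply that stays among maximal states. So
`outer` misses the maximal states. A state outside `I` is needed for the maximum to be positive. -/
theorem HasFixed.not_subset_outer (hσ : σ.Valid) (h : σ.HasFixed I) (hI : ∃ i ∈ σ.S, i ∉ I) :
    ¬ ↑σ.S ⊆ σ.outer I := by
  obtain ⟨u, hsub, -, h0, hpos⟩ := h
  obtain ⟨i₀, hi₀, hi₀'⟩ := hI
  obtain ⟨m, hm, hmax⟩ := Finset.exists_max_image σ.S u ⟨i₀, hi₀⟩
  intro h
  have hum : 0 < u m := ((hpos i₀).2 ⟨hi₀, hi₀'⟩).trans_le (hmax i₀ hi₀)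
  refine lt_irrefl (u m) (leastClosed_subset (R := {i | u i < u m}) ?_ ?_ (h hm))
  · intro i hi
    exact (not_lt.1 fun h' => ((hpos i).1 h').2 hi).trans_lt hum
  · rintro i ⟨a, ha, hb⟩
    have hi := hσ.mem_S i a ha
    by_contra hui
    have hui : u i = u m := le_antisymm (hmax i hi) (not_lt.1 hui)
    obtain ⟨b, hb'⟩ := hsub i hi a ha
    rw [hui] at hb'
    exact Game.not_hits_of_le_mean (fun j hp => hmax j (hσ.mem_S_of_pos ha hp)) hb' (hb b)

/-! ### The reduction step and the correctness of the loop -/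

namespace Valid

theorem escape_subset (hI : I ⊆ σ.S)
    (h : ∀ i ∈ σ.S, i ∈ σ.maxMeets (↑I)ᶜ ↔ i ∉ I) : σ.escape I ⊆ (↑I)ᶜ := by
  refine leastClosed_subset (Set.compl_subset_compl.2 subset_leastClosed) fun i hi hiI => ?_
  exact (h i (hI hiI)).1 hi hiI

/-- The restriction of `u` is a subsolution because the remaining actions never leave the new state
space. MIN can still stay in `I`: the actions that do so avoid `escape`, which is disjoint from `I`,
and therefore survive. -/
theorem hasFixed_reduce (hσ : σ.Valid) (hI : I ⊆ σ.S) (h : σ.HasFixed I) :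
    (σ.reduce I).HasFixed I := by
  classical
  have hE := escape_subset hI (h.maxMeets_iff hσ)
  have hiff := h.maxMeets_iff hσ
  obtain ⟨u, hsub, hsup, h0, hpos⟩ := h
  have hS : ∀ i ∈ (σ.reduce I).S, i ∈ σ.S := fun i hi => by
    rw [hσ.mem_reduce_S] at hi
    exact by_contra fun h => hi (hσ.compl_S_subset_escape h)
  refine hσ.reduce.hasFixed_of_subFixed (w := fun i => if i ∈ (σ.reduce I).S then u i else 0)
    ?_ ?_ ?_ ?_
  · intro i hi hiI hm
    refine (hiff i (hS i hi)).1 (fun a ha => ?_) hiI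
    by_contra! hb
    obtain ⟨b, hb'⟩ := hm a (hσ.mem_reduce_A.2 ⟨ha, fun b hh => hb b (hh.mono hE)⟩)
    exact hb b hb'
  · intro i hi a ha
    obtain ⟨b, hb⟩ := hsub i (hS i hi) a (hσ.mem_reduce_A.1 ha).1
    refine ⟨b, ?_⟩
    simp only [if_pos hi]
    refine hb.trans_eq (Game.mean_congr fun j hp => ?_)
    rw [if_pos (hσ.reduce.mem_S_of_pos ha hp)]
  · intro i
    simp only [Pi.zero_apply]
    split_ifs
    exacts [h0 i, le_rfl]
  · intro i
    by_cases hi : i ∈ (σ.reduce I).S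
    · simp [hi, hpos, hS i hi]
    · simp [hi]

/-- Only a subsolution `v` is required, so that `v = 0` serves when the closure is `I` itself. -/
theorem hasFixed_of_reduce (hσ : σ.Valid) (hI : I ⊆ σ.S)
    (h : ∀ i ∈ σ.S, i ∈ σ.maxMeets (↑I)ᶜ ↔ i ∉ I) {v : Fin n → ℝ} (hv : (σ.reduce I).SubFixed v)
    (hv0 : 0 ≤ v) (hpos : ∀ i, 0 < v i ↔ i ∈ (σ.reduce I).S ∧ i ∉ I) : σ.HasFixed I := by
  classical
  have hE := escape_subset hI h
  have hS : ∀ i, i ∉ σ.S → i ∈ σ.escape I := fun i hi => hσ.compl_S_subset_escape hi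
  set J : Set (Fin n) := ↑σ.S \ σ.outer I with hJdef
  set K : Set (Fin n) := ↑σ.S ∩ σ.escape I with hKdef
  have hJK : J ⊆ K := fun i hi => ⟨hi.1, subset_leastClosed hi.2⟩
  have hKE : ∀ i, i ∉ K → i ∉ σ.maxMeets K ∨ i ∉ σ.S := by
    intro i hi
    by_contra! hh
    exact hi ⟨hh.2, map_leastClosed_subset σ.maxMeets_mono
      (σ.maxMeets_mono Set.inter_subset_right hh.1)⟩
  -- a solution that is positive exactly on `K`
  have hsub1 : σ.SubFixed fun j => 1 * ind J j := by
    intro i hi a ha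
    by_cases hiJ : i ∈ J
    · have : ∃ b, ¬ G.Hits (σ.outer I) i a b := by
        by_contra! hb
        exact hiJ.2 (map_leastClosed_subset σ.minMeets_mono
          (show i ∈ σ.minMeets (σ.outer I) from ⟨a, ha, hb⟩))
      obtain ⟨b, hb⟩ := this
      refine ⟨b, ?_⟩
      rw [Game.mean_congr (y := fun _ => 1), Game.mean_const]
      · simpa using ind_le_one J i
      · intro j hp
        have : j ∈ J := ⟨hσ.mem_S_of_pos ha hp, fun hj => hb ⟨j, hj, hp⟩⟩
        simp [ind, this]
    · refine ⟨0, le_trans (by simp [ind, hiJ]) (Game.mean_nonneg fun j => ?_)⟩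
      simpa using ind_nonneg J j
  obtain ⟨y, hJy, hyK, hy, hy'⟩ := hsub1.exists_fixed
    (hσ.superFixed_indicator (J := K) (c := 1)
      (fun i hi hiK => (hKE i hiK).resolve_right (not_not.2 hi)) zero_le_one)
    (fun i => by
      simp only [one_mul]
      exact Set.indicator_le_indicator_of_subset hJK (fun _ => zero_le_one) i)
  simp only [one_mul] at hJy hyK
  have hy0 : 0 ≤ y := (ind_nonneg J).trans hJy
  have hypos : ∀ i, 0 < y i ↔ i ∈ K := by
    intro i
    refine ⟨fun hi => ind_pos_iff.1 (hi.trans_le (hyK i)), fun hi => ?_⟩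
    -- Positivity spreads from `Φ(I)`, where `y` is at least one, along `maxMeets`: there every
    -- action has a reply with positive expectation, and `y` is a supersolution.
    have hR : σ.escape I ⊆ {i | i ∈ σ.S → 0 < y i} := leastClosed_subset ?_ ?_
    · exact hR hi.2 hi.1
    · exact fun j hj hjS => (ind_pos_iff.2 (show j ∈ J from ⟨hjS, hj⟩)).trans_le (hJy j)
    · intro j hj hjS
      obtain ⟨a, ha, hb⟩ := hy' j hjS
      obtain ⟨b, k, hk, hp⟩ := hj a ha
      exact ((Game.mean_pos_iff hy0).2 ⟨k, hk (hσ.mem_S_of_pos ha hp), hp⟩).trans_le (hb b)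
  -- A common lower bound for the finitely many positive expectations of `y`.
  obtain ⟨δ, hδ, hmin⟩ := exists_pos_le_of_pos
    fun r : (i : Fin n) × Fin (G.numA i) × Fin (G.numB i) => G.mean r.1 r.2.1 r.2.2 y
  set V := ∑ i, v i
  have hV : 0 ≤ V := Finset.sum_nonneg fun i _ => hv0 i
  have hvV : ∀ i, v i ≤ V := fun i => Finset.single_le_sum (fun j _ => hv0 j) (Finset.mem_univ i)
  -- Chosen so that `ε * v i ≤ δ` for all `i`; adding one avoids a division by zero when `v = 0`.
  set ε := δ / (V + 1)
  have hε : 0 < ε := by positivity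
  have hεv : ∀ i, ε * v i ≤ δ := by
    intro i
    calc ε * v i ≤ ε * (V + 1) := by gcongr; linarith [hvV i]
      _ = δ := by simp only [ε]; field_simp
  have hyw : y ≤ fun i => y i + ε * v i :=
    fun i => le_add_of_nonneg_right (mul_nonneg hε.le (hv0 i))
  have hv_zero : ∀ i ∈ σ.escape I, v i = 0 := fun i hi =>
    le_antisymm (not_lt.1 fun h' => hσ.mem_reduce_S.1 ((hpos i).1 h').1 hi) (hv0 i)
  have hy_zero : ∀ i, i ∉ K → y i = 0 := fun i hi =>
    le_antisymm (not_lt.1 fun h' => hi ((hypos i).1 h')) (hy0 i)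
  refine hσ.hasFixed_of_subFixed (fun i hi hiI h' => (h i hi).1 h' hiI)
    (w := fun i => y i + ε * v i) ?_ (hy0.trans hyw) ?_
  · intro i hi a ha
    by_cases hiE : i ∈ σ.escape I
    · obtain ⟨b, hb⟩ := hy i hi a ha
      refine ⟨b, ?_⟩
      simp only [hv_zero i hiE, mul_zero, add_zero]
      exact hb.trans (Game.mean_mono hyw)
    · have hyi : y i = 0 := hy_zero i fun h => hiE h.2
      simp only [hyi, zero_add]
      -- An action that may lead into `escape` is worth at least `δ ≥ ε * v i` to MAX; any other
      -- action survives the reduction, where `v` is a subsolution.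
      by_cases haK : ∃ b, G.Hits (σ.escape I) i a b
      · obtain ⟨b, j, hj, hp⟩ := haK
        refine ⟨b, (hεv i).trans (le_trans ?_ (Game.mean_mono hyw))⟩
        refine hmin ⟨i, a, b⟩ ((Game.mean_pos_iff hy0).2 ⟨j, ?_, hp⟩)
        exact (hypos j).2 ⟨hσ.mem_S_of_pos ha hp, hj⟩
      · push Not at haK
        obtain ⟨b, hb⟩ := hv i (hσ.mem_reduce_S.2 hiE) a (hσ.mem_reduce_A.2 ⟨ha, haK⟩)
        refine ⟨b, (mul_le_mul_of_nonneg_left hb hε.le).trans ?_⟩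
        simp only [Game.mean, Finset.mul_sum]
        refine Finset.sum_le_sum fun j _ => ?_
        nlinarith [mul_nonneg (G.P_nonneg i a b j) (hy0 j)]
  · intro i
    by_cases hiE : i ∈ σ.escape I
    · simp only [hv_zero i hiE, mul_zero, add_zero, hypos]
      exact ⟨fun hi => ⟨hi.1, hE hiE⟩, fun hi => ⟨hi.1, hiE⟩⟩
    · have hyi : y i = 0 := hy_zero i fun h => hiE h.2
      simp only [hyi, zero_add]
      rw [mul_pos_iff_of_pos_left hε, hpos, hσ.mem_reduce_S]
      refine and_congr_left fun _ => ⟨fun _ => ?_, fun _ => hiE⟩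
      exact by_contra fun h => hiE (hS i h)

theorem hasFixed_reduce_iff (hσ : σ.Valid) (hI : I ⊆ σ.S) (h : ¬ σ.Rejects I) :
    (σ.reduce I).HasFixed I ↔ σ.HasFixed I := by
  rw [hσ.rejects_iff, not_or, not_not] at h
  exact ⟨fun ⟨v, hv, _, hv0, hpos⟩ => hσ.hasFixed_of_reduce hI h.1 hv hv0 hpos,
    hσ.hasFixed_reduce hI⟩

theorem hasFixed_of_clo_eq (hσ : σ.Valid) (hI : I ⊆ σ.S) (h : ¬ σ.Rejects I)
    (hc : σ.clo I = σ.sub I) : σ.HasFixed I := by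
  rw [hσ.rejects_iff, not_or, not_not] at h
  refine hσ.hasFixed_of_reduce hI h.1 (v := 0) (fun i _ a _ => ⟨0, ?_⟩) le_rfl fun i => ?_
  · exact Game.mean_nonneg le_rfl
  · rw [hσ.mem_reduce_S, ← (hσ.clo_eq_iff hI).1 hc i]
    simp

theorem not_rejects_of_hasFixed (hσ : σ.Valid) (hI : I ⊂ σ.S) (h : σ.HasFixed I) :
    ¬ σ.Rejects I := by
  rw [hσ.rejects_iff, not_or, not_not]
  exact ⟨h.maxMeets_iff hσ, h.not_subset_outer hσ (Finset.exists_of_ssubset hI)⟩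

/-- Strictness is the invariant of the loop: for `I = S` the test `Φ(I) = ∅` would reject wrongly.
-/
theorem ssubset_reduce_S (hσ : σ.Valid) (hI : I ⊆ σ.S) (h : ¬ σ.Rejects I)
    (hc : σ.clo I ≠ σ.sub I) : I ⊂ (σ.reduce I).S := by
  rw [hσ.rejects_iff, not_or, not_not] at h
  refine lt_of_le_of_ne (fun i hi => hσ.mem_reduce_S.2 fun h' => escape_subset hI h.1 h' hi)
    fun h' => hc ((hσ.clo_eq_iff hI).2 fun i => ?_)
  rw [← hσ.mem_reduce_S, ← h']

/-- The nonempty set `Φ(I)` is discarded. This bounds the number of iterations. -/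
theorem reduce_S_ssubset (hσ : σ.Valid) (h : ¬ σ.Rejects I) :
    (σ.reduce I).S ⊂ σ.S := by
  rw [hσ.rejects_iff, not_or, Set.not_subset] at h
  obtain ⟨-, i, hi, hi'⟩ := h
  refine Finset.ssubset_iff_of_subset (fun j hj => ?_) |>.2 ⟨i, hi, fun h' => ?_⟩
  · exact by_contra fun hjS => hσ.mem_reduce_S.1 hj (hσ.compl_S_subset_escape hjS)
  · exact hσ.mem_reduce_S.1 h' (subset_leastClosed hi')

theorem exists_loop (hσ : σ.Valid) (hI : I ⊂ σ.S) :
    ∃ l ans, Loop I σ l ans ∧ l.length ≤ σ.S.card ∧ (ans = true ↔ σ.HasFixed I) := by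
  induction hs : σ.S using Finset.strongInduction generalizing σ with
  | H s ih =>
    subst hs
    have hcard : 1 ≤ σ.S.card := Finset.card_pos.2 ((Finset.exists_of_ssubset hI).imp fun _ h => h.1)
    by_cases h : σ.Rejects I
    · exact ⟨_, _, .reject σ h, hcard, by
        simpa using fun h' => hσ.not_rejects_of_hasFixed hI h' h⟩
    · by_cases hc : σ.clo I = σ.sub I
      · exact ⟨_, _, .accept σ h hc, hcard, by simpa using hσ.hasFixed_of_clo_eq hI.subset h hc⟩
      · have hlt := hσ.reduce_S_ssubset h
        obtain ⟨l, ans, hl, hlen, hans⟩ :=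
          ih _ hlt hσ.reduce (hσ.ssubset_reduce_S hI.subset h hc) rfl
        refine ⟨_, _, .reduce σ h hc l ans hl, ?_, ?_⟩
        · have := Finset.card_lt_card hlt
          simp only [List.length_cons]
          lia
        · rw [hans, hσ.hasFixed_reduce_iff hI.subset h]

end Valid

theorem hasFixed_full_iff (hI : I.Nonempty) :
    (full G).HasFixed I ↔ ∃ u : Fin n → ℝ, shapley G.P u = u ∧ argmin u = ↑I := by
  have hS : ∀ i, i ∈ (full G).S := fun i => Finset.mem_univ i
  have hA : ∀ i a, a ∈ (full G).A i := fun i a => Finset.mem_univ a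
  have hfix : ∀ u, shapley G.P u = u ↔ (full G).SubFixed u ∧ (full G).SuperFixed u := by
    intro u
    rw [le_antisymm_iff, and_comm]
    refine and_congr ?_ ?_
    · refine forall_congr' fun i => ?_
      rw [shapley, le_iInf_iSup_iff]
      exact ⟨fun h _ a _ => h a, fun h a => h (hS i) a (hA i a)⟩
    · refine forall_congr' fun i => ?_
      rw [shapley, iInf_iSup_le_iff]
      exact ⟨fun ⟨a, h⟩ _ => ⟨a, hA i a, h⟩, fun h => (h (hS i)).imp fun a h => h.2⟩
  simp only [hfix]
  obtain ⟨i₀, hi₀⟩ := hI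
  constructor
  · rintro ⟨u, h1, h2, h0, hpos⟩
    refine ⟨u, ⟨h1, h2⟩, Set.ext fun i => ⟨fun hi => ?_, fun hi j => ?_⟩⟩
    · by_contra hiI
      exact ((hpos i₀).1 (((hpos i).2 ⟨hS i, hiI⟩).trans_le (hi i₀))).2 hi₀
    · exact (not_lt.1 fun h => ((hpos i).1 h).2 hi).trans (h0 j)
  · rintro ⟨u, ⟨h1, h2⟩, harg⟩
    have hmem : ∀ i, i ∈ I ↔ i ∈ argmin u := fun i => by rw [harg]; rfl
    have hmin := (hmem i₀).1 hi₀
    -- Each row of probabilities sums to one, so `F` commutes with adding constants and the minimum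
    -- can be normalized to zero.
    refine ⟨fun i => u i - u i₀, fun i hi a ha => ?_, fun i hi => ?_, fun i => ?_, fun i => ?_⟩
    · simpa [Game.mean_sub_const] using h1 i hi a ha
    · simpa [Game.mean_sub_const] using h2 i hi
    · exact sub_nonneg.2 (hmin i)
    · rw [sub_pos, and_iff_right (hS i), hmem]
      constructor
      · exact fun h hi => absurd (hi i₀) (not_le.2 h)
      · exact fun h => not_le.1 fun h' => h fun j => h'.trans (hmin j)

end LoopState

theorem exists_algorithm {n : ℕ} (hn : 0 < n) (G : Game n) (I : Finset (Fin n)) :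
    ∃ l ans, Algorithm G I l ans ∧ l.length ≤ n ∧
      (ans = true ↔ ∃ u : Fin n → ℝ, shapley G.P u = u ∧ argmin u = ↑I) := by
  rcases I.eq_empty_or_nonempty with h | h
  · refine ⟨_, _, .empty h, Nat.zero_le _, ?_⟩
    have := Fin.pos_iff_nonempty.1 hn
    simp only [Bool.false_eq_true, false_iff, not_exists, not_and]
    intro u _ hu
    obtain ⟨i, hi⟩ := Finite.exists_min u
    have : i ∈ argmin u := hi
    simp [hu, h] at this
  · by_cases h' : I = Finset.univ
    · refine ⟨_, _, .whole h.ne_empty h', Nat.zero_le _, iff_of_true rfl ⟨0, ?_, ?_⟩⟩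
      · ext i
        simp [shapley]
      · simp [h', argmin]
    · obtain ⟨l, ans, hl, hlen, hans⟩ := LoopState.valid_full.exists_loop (G := G)
        (I := I) (Finset.ssubset_univ_iff.2 h')
      refine ⟨l, ans, .loop h.ne_empty h' l ans hl, by simpa [LoopState.full] using hlen, ?_⟩
      rw [hans, LoopState.hasFixed_full_iff h]

theorem Game.m₂_le {n : ℕ} (G : Game n) : G.m₂ ≤ n * G.m ^ 2 := by
  have h : ∀ i, max (G.numA i) (G.numB i) ≤ G.m := fun i =>
    Finset.le_sup (f := fun i => max (G.numA i) (G.numB i)) (Finset.mem_univ i)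
  calc G.m₂ ≤ ∑ _i : Fin n, G.m ^ 2 := Finset.sum_le_sum fun i _ => by
        rw [sq]
        exact Nat.mul_le_mul ((le_max_left _ _).trans (h i)) ((le_max_right _ _).trans (h i))
    _ = n * G.m ^ 2 := by simp

/-! ### Time-bounded Hoare logic with a frame rule -/

namespace Program

/-- Whether the program may change the register `x`. -/
def writes : Program → ℕ → Bool
  | skip, _ => false
  | const x _, z => Nat.beq x z
  | copy x _, z => Nat.beq x z
  | inc x, z => Nat.beq x z
  | dec x, z => Nat.beq x z
  | load x _ _, z => Nat.beq x z
  | store _ _ _, _ => false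
  | test x _ _, z => Nat.beq x z
  | print _, _ => false
  | seq c d, z => c.writes z || d.writes z
  | ifLt _ _ c d, z => c.writes z || d.writes z
  | whileLt _ _ c, z => c.writes z

/-- Whether the program may change the array `k`. -/
def stores : Program → ℕ → Bool
  | store k _ _, z => Nat.beq k z
  | seq c d, z => c.stores z || d.stores z
  | ifLt _ _ c d, z => c.stores z || d.stores z
  | whileLt _ _ c, z => c.stores z
  | _, _ => false

/-- Whether the program may print. -/
def prints : Program → Bool
  | print _ => true
  | seq c d => c.prints || d.prints
  | ifLt _ _ c d => c.prints || d.prints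
  | whileLt _ _ c => c.prints
  | _ => false

/-- Whether the program has no loops. -/
def loopFree : Program → Bool
  | seq c d => c.loopFree && d.loopFree
  | ifLt _ _ c d => c.loopFree && d.loopFree
  | whileLt _ _ _ => false
  | _ => true

/-- A bound on the number of steps of a program without loops. -/
def size : Program → ℕ
  | seq c d => c.size + d.size
  | ifLt _ _ c d => max c.size d.size + 1
  | _ => 1

open Classical in
/-- The effect of a program without loops. -/
noncomputable def effect (T : ℕ → ℕ → ℝ) : Program → Memory → Memory
  | skip, s => s
  | const x k, s => s.setReg x k
  | copy x y, s => s.setReg x (s.reg y)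
  | inc x, s => s.setReg x (s.reg x + 1)
  | dec x, s => s.setReg x (s.reg x - 1)
  | load x k y, s => s.setReg x (s.arr k (s.reg y))
  | store k x y, s => s.setArr k (s.reg x) (s.reg y)
  | test x y z, s => s.setReg x (if 0 < T (s.reg y) (s.reg z) then 1 else 0)
  | print x, s => { s with out := s.out ++ [s.reg x] }
  | seq c d, s => d.effect T (c.effect T s)
  | ifLt x y c d, s => if s.reg x < s.reg y then c.effect T s else d.effect T s
  | whileLt _ _ _, s => s

/-- `for x = 0, …, reg y - 1 do c`. -/
def forLt (x y : ℕ) (c : Program) : Program := seq (const x 0) (whileLt x y (seq c (inc x)))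

end Program

open Program

/-- The memories `s` and `s'` agree up to what `c` may change. -/
structure Frame (c : Program) (s s' : Memory) : Prop where
  reg : ∀ x, c.writes x = false → s'.reg x = s.reg x
  arr : ∀ k, c.stores k = false → s'.arr k = s.arr k
  out : c.prints = false → s'.out = s.out

theorem Frame.refl (c : Program) (s : Memory) : Frame c s s :=
  ⟨fun _ _ => rfl, fun _ _ => rfl, fun _ => rfl⟩

theorem Frame.trans {c : Program} {s s' s'' : Memory} (h : Frame c s s') (h' : Frame c s' s'') :
    Frame c s s'' :=
  ⟨fun x hx => (h'.reg x hx).trans (h.reg x hx), fun k hk => (h'.arr k hk).trans (h.arr k hk),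
    fun ho => (h'.out ho).trans (h.out ho)⟩

theorem Frame.mono {c d : Program} {s s' : Memory} (h : Frame c s s')
    (hw : ∀ x, d.writes x = false → c.writes x = false)
    (hs : ∀ x, d.stores x = false → c.stores x = false)
    (hp : d.prints = false → c.prints = false) : Frame d s s' :=
  ⟨fun x hx => h.reg x (hw x hx), fun k hk => h.arr k (hs k hk), fun ho => h.out (hp ho)⟩

/-- Distinctness is expressed by `Nat.beq`, which evaluates on literals, so side conditions about
concrete programs close by `rfl`. -/
theorem update_of_beq_eq_false {α : Type*} {f : ℕ → α} {v : α} {x y : ℕ}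
    (h : Nat.beq x y = false) : Function.update f x v y = f y :=
  Function.update_of_ne (fun h' => by simp [h'] at h) _ _

theorem Exec.frame {T : ℕ → ℕ → ℝ} {c : Program} {s s' : Memory} {t : ℕ}
    (h : Exec T c s t s') : Frame c s s' := by
  induction h with
  | skip => exact .refl _ _
  | const | copy | inc | dec | load | test =>
    exact ⟨fun z hz => update_of_beq_eq_false hz, fun _ _ => rfl, fun _ => rfl⟩
  | store => exact ⟨fun _ _ => rfl, fun z hz => update_of_beq_eq_false hz, fun _ => rfl⟩
  | print => exact ⟨fun _ _ => rfl, fun _ _ => rfl, fun h => by simp [prints] at h⟩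
  | seq _ _ h1 h2 =>
    refine (h1.mono ?_ ?_ ?_).trans (h2.mono ?_ ?_ ?_) <;>
      simp +contextual [writes, stores, prints]
  | ifTrue _ _ h1 => refine h1.mono ?_ ?_ ?_ <;> simp +contextual [writes, stores, prints]
  | ifFalse _ _ h1 => refine h1.mono ?_ ?_ ?_ <;> simp +contextual [writes, stores, prints]
  | whileFalse => exact .refl _ _
  | whileTrue _ _ _ h1 h2 => exact Frame.trans (c := .whileLt _ _ _) (h1.mono (fun _ => id) (fun _ => id) id) h2

/-- Started in `s`, the program `c` halts after at most `B` steps in a memory satisfying `Q`. -/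
def Runs (T : ℕ → ℕ → ℝ) (c : Program) (s : Memory) (B : ℕ) (Q : Memory → Prop) : Prop :=
  ∃ t s', Exec T c s t s' ∧ t ≤ B ∧ Q s'

namespace Runs

variable {T : ℕ → ℕ → ℝ} {c d : Program} {s : Memory} {B B' : ℕ} {Q Q' : Memory → Prop}

theorem mono (h : Runs T c s B Q) (hB : B ≤ B') (hQ : ∀ s', Frame c s s' → Q s' → Q' s') :
    Runs T c s B' Q' :=
  let ⟨t, s', he, ht, hq⟩ := h
  ⟨t, s', he, ht.trans hB, hQ s' he.frame hq⟩

/-- The second command is given the frame of the first for free, so `Q` has to record only what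
changed. -/
theorem seq (h : Runs T c s B Q) (h' : ∀ s', Frame c s s' → Q s' → Runs T d s' B' Q') :
    Runs T (.seq c d) s (B + B') Q' :=
  let ⟨_, s', he, ht, hq⟩ := h
  let ⟨_, _, he', ht', hq'⟩ := h' s' he.frame hq
  ⟨_, _, he.seq he', add_le_add ht ht', hq'⟩

theorem ifLt {x y : ℕ} (h : s.reg x < s.reg y → Runs T c s B Q)
    (h' : ¬ s.reg x < s.reg y → Runs T d s B Q) : Runs T (.ifLt x y c d) s (B + 1) Q := by
  by_cases hlt : s.reg x < s.reg y
  · obtain ⟨t, s', he, ht, hq⟩ := h hlt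
    exact ⟨_, _, .ifTrue hlt he, by lia, hq⟩
  · obtain ⟨t, s', he, ht, hq⟩ := h' hlt
    exact ⟨_, _, .ifFalse hlt he, by lia, hq⟩

end Runs

theorem exists_exec_effect {T : ℕ → ℕ → ℝ} {c : Program} (hc : c.loopFree = true) (s : Memory) :
    ∃ t, Exec T c s t (c.effect T s) ∧ t ≤ c.size := by
  induction c generalizing s with
  | skip => exact ⟨1, .skip s, le_rfl⟩
  | const x k => exact ⟨1, .const s x k, le_rfl⟩
  | copy x y => exact ⟨1, .copy s x y, le_rfl⟩
  | inc x => exact ⟨1, .inc s x, le_rfl⟩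
  | dec x => exact ⟨1, .dec s x, le_rfl⟩
  | load x k y => exact ⟨1, .load s x k y, le_rfl⟩
  | store k x y => exact ⟨1, .store s k x y, le_rfl⟩
  | test x y z => exact ⟨1, .test s x y z, le_rfl⟩
  | print x => exact ⟨1, .print s x, le_rfl⟩
  | seq c d ihc ihd =>
    simp only [loopFree, Bool.and_eq_true] at hc
    obtain ⟨t, he, ht⟩ := ihc hc.1 s
    obtain ⟨t', he', ht'⟩ := ihd hc.2 (c.effect T s)
    exact ⟨_, he.seq he', add_le_add ht ht'⟩
  | ifLt x y c d ihc ihd =>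
    simp only [loopFree, Bool.and_eq_true] at hc
    simp only [effect, size]
    split_ifs with h
    · obtain ⟨t, he, ht⟩ := ihc hc.1 s
      exact ⟨_, .ifTrue h he, by lia⟩
    · obtain ⟨t, he, ht⟩ := ihd hc.2 s
      exact ⟨_, .ifFalse h he, by lia⟩
  | whileLt => simp [loopFree] at hc

namespace Runs

variable {T : ℕ → ℕ → ℝ} {c d : Program} {s : Memory} {B B' : ℕ} {Q Q' : Memory → Prop}

theorem of_loopFree (hc : c.loopFree = true) (hQ : Q (c.effect T s)) : Runs T c s c.size Q :=
  let ⟨t, he, ht⟩ := exists_exec_effect hc s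
  ⟨t, _, he, ht, hQ⟩

/-- The invariant is evaluated with the counter already advanced. Each pass pays two extra steps,
for the test and the increment; the final two are the initialization and the failing test. -/
theorem forLt {x y N : ℕ} (hx : c.writes x = false) (hy : c.writes y = false)
    (hxy : Nat.beq x y = false) (hN : s.reg y = N) (Inv : ℕ → Memory → Prop) (B : ℕ → ℕ)
    (h0 : Inv 0 (s.setReg x 0))
    (step : ∀ k s', k < N → Frame (.forLt x y c) s s' → s'.reg x = k → Inv k s' →
      Runs T c s' (B k) fun s'' => Inv (k + 1) (s''.setReg x (k + 1))) :
    Runs T (.forLt x y c) s (∑ k ∈ Finset.range N, (B k + 2) + 2) (Inv N) := by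
  -- Induction on the number `m` of passes that remain.
  have main : ∀ m k s', k + m = N → Frame (.forLt x y c) s s' → s'.reg x = k → Inv k s' →
      Runs T (.whileLt x y (.seq c (.inc x))) s' (∑ j ∈ Finset.Ico k N, (B j + 2) + 1) (Inv N) := by
    intro m
    induction m with
    | zero =>
      intro k s' hk hf hr hi
      obtain rfl : k = N := by lia
      refine ⟨1, s', .whileFalse ?_, by simp, hi⟩
      rw [hr, hf.reg y, hN]
      · exact lt_irrefl _
      · simp [Program.forLt, writes, hy, hxy]
    | succ m ih =>
      intro k s' hk hf hr hi
      have hkN : k < N := by lia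
      obtain ⟨t, s₁, he, ht, hq⟩ := step k s' hkN hf hr hi
      have hrx : s₁.reg x = k := (he.frame.reg x hx).trans hr
      have he' : Exec T (.seq c (.inc x)) s' (t + 1) (s₁.setReg x (k + 1)) := by
        have := Exec.inc (T := T) s₁ x
        rw [hrx] at this
        exact he.seq this
      have hf' : Frame (.forLt x y c) s' (s₁.setReg x (k + 1)) := by
        refine he'.frame.mono ?_ ?_ ?_ <;> simp +contextual [Program.forLt, writes, stores, prints]
      obtain ⟨t', s₂, hw, ht', hq'⟩ := ih (k + 1) (s₁.setReg x (k + 1)) (by lia) (hf.trans hf')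
        (by simp [Memory.setReg]) hq
      refine ⟨_, s₂, .whileTrue ?_ he' hw, ?_, hq'⟩
      · rw [hr, hf.reg y, hN]
        · exact hkN
        · simp [Program.forLt, writes, hy, hxy]
      · rw [Finset.sum_eq_sum_Ico_succ_bot hkN]
        lia
  obtain ⟨t, s', he, ht, hq⟩ := main N 0 (s.setReg x 0) (by simp) (by
    refine (Exec.const (T := T) s x 0).frame.mono ?_ ?_ ?_ <;>
      simp +contextual [Program.forLt, writes, stores, prints]) (by simp [Memory.setReg]) h0
  refine ⟨_, s', (Exec.const s x 0).seq he, ?_, hq⟩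
  rw [Finset.range_eq_Ico]
  lia

theorem forLt_const {x y N B : ℕ} (hx : c.writes x = false) (hy : c.writes y = false)
    (hxy : Nat.beq x y = false) (hN : s.reg y = N) (Inv : ℕ → Memory → Prop)
    (h0 : Inv 0 (s.setReg x 0))
    (step : ∀ k s', k < N → Frame (.forLt x y c) s s' → s'.reg x = k → Inv k s' →
      Runs T c s' B fun s'' => Inv (k + 1) (s''.setReg x (k + 1))) :
    Runs T (.forLt x y c) s (N * (B + 2) + 2) (Inv N) := by
  refine (forLt hx hy hxy hN Inv (fun _ => B) h0 step).mono ?_ fun _ _ h => h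
  simp

theorem forLt_loopFree {x y N : ℕ} (hc : c.loopFree = true) (hx : c.writes x = false)
    (hy : c.writes y = false) (hxy : Nat.beq x y = false) (hN : s.reg y = N)
    (Inv : ℕ → Memory → Prop) (h0 : Inv 0 (s.setReg x 0))
    (step : ∀ k s', k < N → Frame (.forLt x y c) s s' → s'.reg x = k → Inv k s' →
      Inv (k + 1) ((c.effect T s').setReg x (k + 1))) :
    Runs T (.forLt x y c) s (N * (c.size + 2) + 2) (Inv N) :=
  forLt_const hx hy hxy hN Inv h0 fun k s' hk hf hr hi => of_loopFree hc (step k s' hk hf hr hi)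

/-- A loop that computes the entries of an array one after the other. -/
theorem forLt_map {x y N k : ℕ} (hc : c.loopFree = true) (hx : c.writes x = false)
    (hy : c.writes y = false) (hxy : Nat.beq x y = false) (hN : s.reg y = N) (f : ℕ → ℕ)
    (step : ∀ p s', p < N → Frame (.forLt x y c) s s' → s'.reg x = p →
      s'.arr k p = s.arr k p →
      (c.effect T s').arr k = Function.update (s'.arr k) p (f p)) :
    Runs T (.forLt x y c) s (N * (c.size + 2) + 2) fun s' => ∀ p < N, s'.arr k p = f p := by
  refine (forLt_loopFree hc hx hy hxy hN
    -- Entries not yet reached keep their old values; this allows loops that transform an array in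
    -- place.
    (fun m s' => ∀ p, s'.arr k p = if p < m then f p else s.arr k p) (fun p => by simp; rfl)
    fun m s' hm hf hr hi p => ?_).mono le_rfl fun s' _ h p hp => by rw [h, if_pos hp]
  have := step m s' hm hf hr (by rw [hi, if_neg (lt_irrefl m)])
  simp only [Memory.setReg, this, Function.update_apply]
  split_ifs with h1 h2 h3
  · rw [h1]
  · lia
  · rw [hi, if_pos (by lia)]
  · rw [hi, if_neg (by lia)]

open Classical in
/-- A loop that sets the entries of an array at certain positions to one. -/
theorem forLt_scatter {x y N k : ℕ} (hc : c.loopFree = true) (hx : c.writes x = false)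
    (hy : c.writes y = false) (hxy : Nat.beq x y = false) (hN : s.reg y = N) (φ : ℕ → Prop)
    (g : ℕ → ℕ)
    (step : ∀ p s', p < N → Frame (.forLt x y c) s s' → s'.reg x = p →
      (c.effect T s').arr k = if φ p then Function.update (s'.arr k) (g p) 1 else s'.arr k) :
    Runs T (.forLt x y c) s (N * (c.size + 2) + 2) fun s' =>
      ∀ q, s'.arr k q = if ∃ p < N, φ p ∧ g p = q then 1 else s.arr k q := by
  refine forLt_loopFree hc hx hy hxy hN
    (fun m s' => ∀ q, s'.arr k q = if ∃ p < m, φ p ∧ g p = q then 1 else s.arr k q)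
    (fun p => by simp; rfl) fun m s' hm hf hr hi q => ?_
  have h1 : (∃ p < m + 1, φ p ∧ g p = q) ↔ (∃ p < m, φ p ∧ g p = q) ∨ (φ m ∧ g m = q) := by
    constructor
    · rintro ⟨p, hp, h⟩
      rcases Nat.lt_succ_iff_lt_or_eq.1 hp with h' | rfl
      · exact .inl ⟨p, h', h⟩
      · exact .inr h
    · rintro (⟨p, hp, h⟩ | h)
      · exact ⟨p, by lia, h⟩
      · exact ⟨m, by lia, h⟩
  simp only [Memory.setReg, step m s' hm hf hr, h1]
  by_cases hφ : φ m
  · by_cases hg : g m = q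
    · simp [hφ, hg]
    · simp [hφ, hg, hi q, Function.update_of_ne (Ne.symm hg)]
  · simp [hφ, hi q]

open Classical in
/-- A loop that looks for an index with a certain property. -/
theorem forLt_select {x y N r : ℕ} (hc : c.loopFree = true) (hx : c.writes x = false)
    (hy : c.writes y = false) (hxy : Nat.beq x y = false) (hN : s.reg y = N)
    (hxr : Nat.beq x r = false) (φ : ℕ → Prop) (v : ℕ → ℕ)
    (step : ∀ p s', p < N → Frame (.forLt x y c) s s' → s'.reg x = p →
      (c.effect T s').reg r = if φ p then v p else s'.reg r) :
    Runs T (.forLt x y c) s (N * (c.size + 2) + 2) fun s' =>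
      (∃ p < N, φ p ∧ s'.reg r = v p) ∨ (∀ p < N, ¬ φ p) ∧ s'.reg r = s.reg r := by
  refine forLt_loopFree hc hx hy hxy hN
    (fun m s' => (∃ p < m, φ p ∧ s'.reg r = v p) ∨ (∀ p < m, ¬ φ p) ∧ s'.reg r = s.reg r)
    (.inr ⟨fun p hp => by lia, update_of_beq_eq_false hxr⟩) fun m s' hm hf hr hi => ?_
  have h1 : ((c.effect T s').setReg x (m + 1)).reg r = if φ m then v m else s'.reg r :=
    (update_of_beq_eq_false hxr).trans (step m s' hm hf hr)
  rw [h1]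
  by_cases hφ : φ m
  · exact .inl ⟨m, by lia, hφ, if_pos hφ⟩
  · rw [if_neg hφ]
    refine hi.imp (fun ⟨p, hp, h⟩ => ⟨p, by lia, h⟩) (fun ⟨h, h'⟩ => ⟨fun p hp => ?_, h'⟩)
    rcases Nat.lt_succ_iff_lt_or_eq.1 hp with h'' | rfl
    · exact h p h''
    · exact hφ

end Runs

namespace Memory

variable (s : Memory) (x v k p : ℕ)

@[simp] theorem setReg_reg : (s.setReg x v).reg = Function.update s.reg x v := rfl
@[simp] theorem setReg_arr : (s.setReg x v).arr = s.arr := rfl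
@[simp] theorem setReg_out : (s.setReg x v).out = s.out := rfl
@[simp] theorem setArr_reg : (s.setArr k p v).reg = s.reg := rfl
@[simp] theorem setArr_arr : (s.setArr k p v).arr =
    Function.update s.arr k (Function.update (s.arr k) p v) := rfl

end Memory

/-! ### Lexicographic numbering of the triples -/

section Rows

variable {n : ℕ} (G : Game n)

/-- The triples `(i, a, b)`. -/
abbrev Row : Type := (i : Fin n) × Fin (G.numA i) × Fin (G.numB i)

variable {G}

/-- The row of the input tape that belongs to a triple. -/
def Row.index (r : Row G) : ℕ := tripleIndex G r.1 r.2.1 r.2.2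

/-- The first row of the input tape that belongs to a pair `(i, a)`. -/
def pairIndex (i : Fin n) (a : Fin (G.numA i)) : ℕ := tripleIndex G i a 0

variable (G) in
/-- The first row of the input tape that belongs to a state `≥ k`. -/
def baseIndex (k : ℕ) : ℕ := ∑ i with i.val < k, G.numA i * G.numB i

theorem baseIndex_zero : baseIndex G 0 = 0 := by simp [baseIndex]

theorem baseIndex_succ (i : Fin n) :
    baseIndex G (i + 1) = baseIndex G i + G.numA i * G.numB i := by
  have : (Finset.univ.filter fun j : Fin n => j.val < i + 1)
      = insert i (Finset.univ.filter fun j : Fin n => j.val < i) := by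
    ext j
    simp only [Finset.mem_filter, Finset.mem_univ, true_and, Finset.mem_insert, Fin.ext_iff]
    lia
  rw [baseIndex, this, Finset.sum_insert (by simp), baseIndex, add_comm]

theorem baseIndex_self : baseIndex G n = G.m₂ := by simp [baseIndex, Game.m₂]

theorem baseIndex_mono : Monotone (baseIndex G) := fun k l h =>
  Finset.sum_le_sum_of_subset fun i => by simpa using fun h' => lt_of_lt_of_le h' h

theorem tripleIndex_eq (i : Fin n) (a : Fin (G.numA i)) (b : Fin (G.numB i)) :
    tripleIndex G i a b = baseIndex G i + (a * G.numB i + b) := by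
  rw [tripleIndex, baseIndex]
  congr 2
  ext j
  simp

theorem pairIndex_eq (i : Fin n) (a : Fin (G.numA i)) :
    pairIndex i a = baseIndex G i + a * G.numB i := by
  rw [pairIndex, tripleIndex_eq]
  simp

theorem pair_lt {k l a b : ℕ} (ha : a < k) (hb : b < l) : a * l + b < k * l := by
  calc a * l + b < (a + 1) * l := by rw [Nat.add_mul]; lia
    _ ≤ k * l := Nat.mul_le_mul_right l ha

/-- The rows of a state lie between `baseIndex` of it and of its successor, so these blocks are
disjoint; within a block, division by `G.numB i` recovers the two actions. -/
theorem Row.index_injective : Function.Injective (Row.index (G := G)) := by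
  rintro ⟨i, a, b⟩ ⟨i', a', b'⟩ h
  simp only [Row.index, tripleIndex_eq] at h
  have key : ∀ {i i' : Fin n} {a : Fin (G.numA i)} {b : Fin (G.numB i)} {a' : Fin (G.numA i')}
      {b' : Fin (G.numB i')}, baseIndex G i + (a * G.numB i + b)
        = baseIndex G i' + (a' * G.numB i' + b') → ¬ i < i' := by
    intro i i' a b a' b' h hlt
    have h1 := baseIndex_mono (G := G) (Nat.succ_le_of_lt hlt)
    have h2 := baseIndex_succ (G := G) i
    have h3 := pair_lt a.2 b.2
    simp only [Nat.succ_eq_add_one] at h1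
    omega
  obtain rfl : i = i' := le_antisymm (not_lt.1 (key h.symm)) (not_lt.1 (key h))
  have hab : (a : ℕ) * G.numB i + b = a' * G.numB i + b' := by lia
  have hb : (b : ℕ) = b' := by
    have := congrArg (· % G.numB i) hab
    simpa [Nat.mul_add_mod', Nat.mod_eq_of_lt] using this
  have ha : (a : ℕ) = a' := by
    rw [hb] at hab
    exact Nat.eq_of_mul_eq_mul_right (G.numB_pos i) (by lia)
  rw [Fin.ext ha, Fin.ext hb]

theorem Row.index_lt (r : Row G) : r.index < G.m₂ := by
  obtain ⟨i, a, b⟩ := r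
  have h1 := baseIndex_mono (G := G) (Nat.succ_le_of_lt i.2)
  have h2 := baseIndex_succ (G := G) i
  have h3 := pair_lt a.2 b.2
  rw [baseIndex_self] at h1
  simp only [Row.index, tripleIndex_eq, Nat.succ_eq_add_one] at *
  lia

theorem tripleIndex_lt (i : Fin n) (a : Fin (G.numA i)) (b : Fin (G.numB i)) :
    tripleIndex G i a b < G.m₂ := Row.index_lt ⟨i, a, b⟩

/-- An injection between finite sets with equally many elements is onto. -/
theorem Row.exists_index_eq {t : ℕ} (ht : t < G.m₂) : ∃ r : Row G, r.index = t := by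
  have hinj : Function.Injective fun r : Row G => (⟨r.index, r.index_lt⟩ : Fin G.m₂) :=
    fun r r' h => Row.index_injective (Fin.mk.inj h)
  have hcard : Fintype.card (Row G) = Fintype.card (Fin G.m₂) := by
    rw [Fintype.card_fin, Game.m₂]
    simp
  obtain ⟨r, hr⟩ := ((Fintype.bijective_iff_injective_and_card _).2 ⟨hinj, hcard⟩).2 ⟨t, ht⟩
  exact ⟨r, congrArg Fin.val hr⟩

/-- Lets one flat loop over the rows of the tape stand for a quantifier over triples. -/
theorem exists_lt_m₂_iff {p : ℕ → Prop} : (∃ t < G.m₂, p t) ↔ ∃ r : Row G, p r.index := by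
  constructor
  · rintro ⟨t, ht, h⟩
    obtain ⟨r, rfl⟩ := Row.exists_index_eq ht
    exact ⟨r, h⟩
  · rintro ⟨r, h⟩
    exact ⟨_, r.index_lt, h⟩

theorem pairIndex_eq_iff {i i' : Fin n} {a : Fin (G.numA i)} {a' : Fin (G.numA i')} :
    pairIndex i a = pairIndex i' a' ↔ (⟨i, a⟩ : (i : Fin n) × Fin (G.numA i)) = ⟨i', a'⟩ := by
  constructor
  · intro h
    have := Row.index_injective (G := G) (a₁ := ⟨i, a, 0⟩) (a₂ := ⟨i', a', 0⟩) h
    obtain rfl : i = i' := congrArg Sigma.fst this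
    simpa using this
  · intro h
    obtain rfl : i = i' := congrArg Sigma.fst h
    obtain rfl : a = a' := by simpa using h
    rfl

/-- Every state has at least one triple, so passes over the states are absorbed in `O(m₂)`. -/
theorem le_m₂ : n ≤ G.m₂ := by
  calc n = ∑ _i : Fin n, 1 := by simp
    _ ≤ G.m₂ := Finset.sum_le_sum fun i _ => Nat.mul_pos (G.numA_pos i) (G.numB_pos i)

end Rows

/-! ### Layout of the memory -/

section Encoding

open Classical in
/-- The entries of `f` at the positions of the states are the characteristic vector of `D`. -/
def Encodes {n : ℕ} (f : ℕ → ℕ) (D : Set (Fin n)) : Prop := ∀ i : Fin n, f i = if i ∈ D then 1 else 0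

open Classical in
/-- The entries of `f` at the positions of the triples are the characteristic function of `φ`. -/
def EncodesRows {n : ℕ} {G : Game n} (f : ℕ → ℕ)
    (φ : (i : Fin n) → Fin (G.numA i) → Fin (G.numB i) → Prop) : Prop :=
  ∀ i a b, f (tripleIndex G i a b) = if φ i a b then 1 else 0

/-- The registers and arrays that hold the data of the game and the loop variables. -/
structure Holds {n : ℕ} {G : Game n} (I : Finset (Fin n)) (σ : LoopState G) (s : Memory) :
    Prop where
  reg_zero : s.reg 0 = n
  reg_one : s.reg 1 = 0
  reg_two : s.reg 2 = 1
  reg_three : s.reg 3 = G.m₂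
  numA : ∀ i : Fin n, s.arr 0 i = G.numA i
  numB : ∀ i : Fin n, s.arr 1 i = G.numB i
  target : Encodes (s.arr 2) (I : Set (Fin n))
  state : ∀ i a b, s.arr 12 (tripleIndex G i a b) = i
  pair : ∀ i a b, s.arr 13 (tripleIndex G i a b) = pairIndex i a
  states : Encodes (s.arr 3) (σ.S : Set (Fin n))
  actions : EncodesRows (s.arr 4) fun i a (_ : Fin (G.numB i)) => a ∈ σ.A i

/-- The program keeps the data of the game and the loop variables. -/
def Keeps (c : Program) : Bool :=
  !(c.writes 0 || c.writes 1 || c.writes 2 || c.writes 3 || c.stores 0 || c.stores 1 || c.stores 2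
    || c.stores 3 || c.stores 4 || c.stores 12 || c.stores 13)

variable {n : ℕ} {G : Game n} {I : Finset (Fin n)} {σ : LoopState G} {s s' : Memory}
  {c : Program}

theorem Holds.frame (h : Holds I σ s) (hf : Frame c s s') (hc : Keeps c = true) :
    Holds I σ s' := by
  simp only [Keeps, Bool.not_eq_true', Bool.or_eq_false_iff] at hc
  obtain ⟨⟨⟨⟨⟨⟨⟨⟨⟨⟨h0, h1⟩, h2⟩, h3⟩, k0⟩, k1⟩, k2⟩, k3⟩, k4⟩, k12⟩, k13⟩ := hc
  obtain ⟨e0, e1, e2, e3, a0, a1, a2, a12, a13, a3, a4⟩ := h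
  constructor
  · rw [hf.reg 0 h0, e0]
  · rw [hf.reg 1 h1, e1]
  · rw [hf.reg 2 h2, e2]
  · rw [hf.reg 3 h3, e3]
  · rwa [hf.arr 0 k0]
  · rwa [hf.arr 1 k1]
  · rwa [hf.arr 2 k2]
  · rwa [hf.arr 12 k12]
  · rwa [hf.arr 13 k13]
  · rwa [hf.arr 3 k3]
  · rwa [hf.arr 4 k4]

end Encoding

/-! ### Subroutines -/

section Routines

/-- `arr k [p] := 0` for `p < reg y`. -/
def clear (k y : ℕ) : Program := .forLt 4 y (.store k 4 1)

/-- `arr l [i] := 1 - arr k [i]` for all states `i`. -/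
def complement (k l : ℕ) : Program :=
  .forLt 4 0 (.seq (.load 5 k 4) (.ifLt 5 2 (.store l 4 2) (.store l 4 1)))

/-- Mark the triples that lead to the state in register `y`. -/
def mark (y : ℕ) : Program :=
  .forLt 4 3 (.seq (.test 5 4 y) (.ifLt 1 5 (.store 5 4 2) .skip))

/-- For all pairs `(i, a)`, whether some triple `(i, a, b)` is marked (if `d`) or unmarked. -/
def collectPairs (d : Bool) : Program :=
  .forLt 4 3 (.seq (.load 5 5 4) (.seq (.load 6 13 4)
    (if d then .ifLt 1 5 (.store 8 6 2) .skip else .ifLt 5 2 (.store 8 6 2) .skip)))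

/-- The states with an action `a` that the previous routine did not select. -/
def collectStates : Program :=
  .forLt 4 3 (.seq (.load 6 13 4) (.seq (.load 5 8 6) (.ifLt 1 5 .skip
    (.seq (.load 5 4 4) (.ifLt 1 5 (.seq (.load 6 12 4) (.store 9 6 2)) .skip)))))

/-- The states with an action `a` such that no triple `(i, a, b)` is marked (if `d`) or unmarked. -/
def assess (d : Bool) : Program :=
  .seq (clear 8 3) (.seq (clear 9 0) (.seq (collectPairs d) collectStates))

/-- Put into register `9` some removed state that has not been processed yet. -/
def pick : Program :=
  .forLt 4 0 (.seq (.load 5 7 4) (.seq (.load 6 6 4) (.ifLt 5 6 (.copy 9 4) .skip)))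

/-- Remove the states according to the last assessment. -/
def remove (d : Bool) : Program :=
  .forLt 4 0 (.seq (.load 5 9 4)
    (if d then .ifLt 5 2 (.store 6 4 2) .skip else .ifLt 1 5 (.store 6 4 2) .skip))

/-- Close the set in the array `6` under `maxMeets` (if `d`) or `minMeets`. -/
def close (d : Bool) : Program :=
  .seq (clear 7 0) (.seq (clear 5 3) (.forLt 8 0 (.seq (.copy 9 0) (.seq pick
    (.ifLt 9 0 (.seq (.store 7 9 2) (.seq (mark 9) (.seq (assess d) (remove d)))) .skip)))))

/-- Mark the triples that lead to the set in the array `6`. -/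
def markAll : Program :=
  .seq (clear 5 3) (.forLt 10 0 (.seq (.load 5 6 10) (.ifLt 1 5 (mark 10) .skip)))

variable {n : ℕ} {G : Game n} {I : Finset (Fin n)} {σ : LoopState G} {s : Memory}
  {T : ℕ → ℕ → ℝ}

theorem runs_clear {k y N : ℕ} (hN : s.reg y = N) (h1 : s.reg 1 = 0) (hy : Nat.beq 4 y = false) :
    Runs T (clear k y) s (3 * N + 2) fun s' => ∀ p < N, s'.arr k p = 0 := by
  refine (Runs.forLt_map (k := k) rfl rfl rfl hy hN (fun _ => 0)
    fun p s' _ hf hr _ => ?_).mono ?_ fun _ _ h => h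
  · have := hf.reg 1 rfl
    simp [effect, hr, this, h1]
  · simp only [size]
    lia

theorem runs_complement {k l : ℕ} {D : Set (Fin n)} (h : Holds I σ s) (hD : Encodes (s.arr k) D)
    (hl : Nat.beq k l = true ∨ Nat.beq l k = false) :
    Runs T (complement k l) s (10 * n + 2) fun s' => Encodes (s'.arr l) Dᶜ := by
  classical
  refine (Runs.forLt_map (k := l) rfl rfl rfl rfl h.reg_zero (fun p => 1 - s.arr k p)
    fun p s' hp hf hr hi => ?_).mono ?_ fun s' _ h i => ?_
  · have h1 : s'.reg 1 = 0 := (hf.reg 1 rfl).trans h.reg_one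
    have h2 : s'.reg 2 = 1 := (hf.reg 2 rfl).trans h.reg_two
    have hk : s'.arr k p = s.arr k p := by
      rcases hl with hl | hl
      · rwa [Nat.eq_of_beq_eq_true hl]
      · rw [hf.arr k]
        simp [Program.forLt, stores, hl]
    have hb := hD ⟨p, hp⟩
    simp only at hb
    simp only [effect, Memory.setReg_reg, Function.update_self, hr, hk, hb]
    split_ifs <;> simp_all
  · simp only [size]
    lia
  · rw [h i i.2, hD i]
    by_cases hi : i ∈ D <;> simp [hi]

theorem runs_mark {y j : ℕ} (h : Holds I σ s) (hj : s.reg y = j) (hy4 : Nat.beq 4 y = false)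
    (hy5 : Nat.beq 5 y = false) {φ : (i : Fin n) → Fin (G.numA i) → Fin (G.numB i) → Prop}
    (hφ : EncodesRows (s.arr 5) φ) :
    Runs T (mark y) s (10 * G.m₂ + 2) fun s' =>
      EncodesRows (s'.arr 5) fun i a b => φ i a b ∨ 0 < T (tripleIndex G i a b) j := by
  classical
  refine (Runs.forLt_map (k := 5) rfl rfl rfl rfl h.reg_three
    (fun p => if 0 < T p j then 1 else s.arr 5 p)
    fun p s' hp hf hr hi => ?_).mono ?_ fun s' _ h i a b => ?_
  · have h1 : s'.reg 1 = 0 := (hf.reg 1 rfl).trans h.reg_one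
    have h2 : s'.reg 2 = 1 := (hf.reg 2 rfl).trans h.reg_two
    have hj' : s'.reg y = j := by
      refine (hf.reg y ?_).trans hj
      simp [Program.forLt, writes, hy4, hy5]
    by_cases hT : 0 < T p j
    · simp [effect, hr, h1, h2, hj', hT]
    · simp [effect, hr, h1, hj', hT, ← hi]
  · simp only [size]
    lia
  · rw [h _ (tripleIndex_lt i a b), hφ]
    by_cases h1 : 0 < T (tripleIndex G i a b) j <;> simp [h1]

end Routines

theorem ite_one_zero_congr {p q : Prop} {dp : Decidable p} {dq : Decidable q} (h : p ↔ q) :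
    (if p then 1 else 0 : ℕ) = if q then 1 else 0 := by
  split_ifs <;> simp_all

section Routines

variable {n : ℕ} {G : Game n} {I : Finset (Fin n)} {σ : LoopState G} {s : Memory}
  {T : ℕ → ℕ → ℝ}

open Classical in
-- All rows of a pair write to one cell, that of its first row, so the existential over `b` is a
-- disjunction formed by overwriting.
theorem runs_collectPairs {d : Bool} (h : Holds I σ s)
    {φ : (i : Fin n) → Fin (G.numA i) → Fin (G.numB i) → Prop}
    (hφ : EncodesRows (s.arr 5) φ) (h0 : ∀ p < G.m₂, s.arr 8 p = 0) :
    Runs T (collectPairs d) s (10 * G.m₂ + 2) fun s' => ∀ i a,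
      s'.arr 8 (pairIndex i a) = if ∃ b, (φ i a b ↔ d = true) then 1 else 0 := by
  refine (Runs.forLt_scatter (k := 8) (by cases d <;> rfl) (by cases d <;> rfl)
    (by cases d <;> rfl) rfl h.reg_three
    (fun p => if d then 0 < s.arr 5 p else s.arr 5 p < 1) (fun p => s.arr 13 p)
    fun p s' hp hf hr => ?_).mono ?_ fun s' _ h' i a => ?_
  · have h1 : s'.reg 1 = 0 := (hf.reg 1 (by cases d <;> rfl)).trans h.reg_one
    have h2 : s'.reg 2 = 1 := (hf.reg 2 (by cases d <;> rfl)).trans h.reg_two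
    have h5 : s'.arr 5 = s.arr 5 := hf.arr 5 (by cases d <;> rfl)
    have h13 : s'.arr 13 = s.arr 13 := hf.arr 13 (by cases d <;> rfl)
    cases d
    · by_cases hb : s.arr 5 p = 0 <;> simp [effect, hr, h2, h5, h13, hb]
    · by_cases hb : 0 < s.arr 5 p <;> simp [effect, hr, h1, h2, h5, h13, hb]
  · cases d <;> simp only [size, Bool.false_eq_true, if_true, if_false] <;> lia
  · rw [h', h0 (pairIndex i a) (tripleIndex_lt i a 0)]
    refine ite_one_zero_congr (exists_lt_m₂_iff.trans ?_)
    constructor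
    · rintro ⟨⟨i', a', b'⟩, hb, he⟩
      simp only [Row.index, h.pair, pairIndex_eq_iff, hφ i' a' b'] at hb he
      obtain rfl : i' = i := congrArg Sigma.fst he
      obtain rfl : a' = a := by simpa using he
      refine ⟨b', ?_⟩
      cases d <;> by_cases hb' : φ i' a' b' <;> simp_all
    · rintro ⟨b, hb⟩
      refine ⟨⟨i, a, b⟩, ?_, h.pair i a b⟩
      simp only [Row.index, hφ i a b]
      cases d <;> simp_all

open Classical in
theorem runs_collectStates (h : Holds I σ s) {ψ : (i : Fin n) → Fin (G.numA i) → Prop}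
    (hψ : ∀ i a, s.arr 8 (pairIndex i a) = if ψ i a then 1 else 0)
    (h0 : ∀ p < n, s.arr 9 p = 0) :
    Runs T collectStates s (10 * G.m₂ + 2) fun s' =>
      Encodes (s'.arr 9) {i | ∃ a ∈ σ.A i, ¬ ψ i a} := by
  refine (Runs.forLt_scatter (k := 9) rfl rfl rfl rfl h.reg_three
    (fun p => 0 < s.arr 4 p ∧ s.arr 8 (s.arr 13 p) = 0) (fun p => s.arr 12 p)
    fun p s' hp hf hr => ?_).mono ?_ fun s' _ h' i => ?_
  · have h1 : s'.reg 1 = 0 := (hf.reg 1 rfl).trans h.reg_one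
    have h2 : s'.reg 2 = 1 := (hf.reg 2 rfl).trans h.reg_two
    have h4 : s'.arr 4 = s.arr 4 := hf.arr 4 rfl
    have h8 : s'.arr 8 = s.arr 8 := hf.arr 8 rfl
    have h12 : s'.arr 12 = s.arr 12 := hf.arr 12 rfl
    have h13 : s'.arr 13 = s.arr 13 := hf.arr 13 rfl
    by_cases hb : s.arr 8 (s.arr 13 p) = 0
    · by_cases ha : 0 < s.arr 4 p <;> simp [effect, hr, h1, h2, h4, h8, h12, h13, hb, ha]
    · simp [effect, hr, h1, h8, h13, hb, Nat.pos_of_ne_zero hb]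
  · simp only [size]
    lia
  · rw [h', h0 i i.2]
    refine ite_one_zero_congr (exists_lt_m₂_iff.trans ?_)
    constructor
    · rintro ⟨⟨i', a', b'⟩, ⟨ha, hb⟩, he⟩
      simp only [Row.index, h.pair, h.state, hψ, h.actions i' a' b'] at ha hb he
      obtain rfl : i' = i := Fin.ext he
      exact ⟨a', by_contra fun h => by simp [h] at ha, by simpa using hb⟩
    · rintro ⟨a, ha, hb⟩
      -- Any `b` serves as a witness, because the entries for actions are repeated in all rows of
      -- the pair.
      refine ⟨⟨i, a, 0⟩, ?_, h.state i a 0⟩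
      simp [Row.index, h.pair, hψ, h.actions i a 0, ha, hb]

open Classical in
theorem runs_assess {d : Bool} (hn : 0 < n) (h : Holds I σ s)
    {φ : (i : Fin n) → Fin (G.numA i) → Fin (G.numB i) → Prop}
    (hφ : EncodesRows (s.arr 5) φ) :
    Runs T (assess d) s (40 * G.m₂) fun s' =>
      (∀ i a, s'.arr 8 (pairIndex i a) = if ∃ b, (φ i a b ↔ d = true) then 1 else 0) ∧
      Encodes (s'.arr 9) {i | ∃ a ∈ σ.A i, ¬ ∃ b, (φ i a b ↔ d = true)} := by
  have hM : n ≤ G.m₂ := le_m₂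
  refine Runs.mono (B := 3 * G.m₂ + 2 + (3 * n + 2 + (10 * G.m₂ + 2 + (10 * G.m₂ + 2))))
    (Runs.seq (runs_clear h.reg_three h.reg_one rfl) fun s₁ f₁ q₁ => ?_) ?_ fun _ _ h => h
  · have k₁ := h.frame f₁ rfl
    refine Runs.seq (runs_clear k₁.reg_zero k₁.reg_one rfl) fun s₂ f₂ q₂ => ?_
    have k₂ := k₁.frame f₂ rfl
    refine Runs.seq (runs_collectPairs (d := d) k₂ (φ := φ) ?_ fun p hp => ?_) fun s₃ f₃ q₃ => ?_
    · rw [f₂.arr 5 rfl, f₁.arr 5 rfl]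
      exact hφ
    · rw [f₂.arr 8 rfl, q₁ p hp]
    · have k₃ := k₂.frame f₃ (by cases d <;> rfl)
      refine (runs_collectStates k₃ (fun i a => (q₃ i a).trans (ite_one_zero_congr Iff.rfl))
        fun p hp => ?_).mono le_rfl fun s₄ f₄ q₄ => ⟨?_, q₄⟩
      · rw [f₃.arr 9 (by cases d <;> rfl), q₂ p hp]
      · rwa [f₄.arr 8 rfl]
  · lia

theorem runs_pick (h0 : s.reg 0 = n) (h9 : s.reg 9 = n) :
    Runs T pick s (10 * n + 2) fun s' =>
      (∃ p < n, s.arr 7 p < s.arr 6 p ∧ s'.reg 9 = p) ∨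
        (∀ p < n, ¬ s.arr 7 p < s.arr 6 p) ∧ s'.reg 9 = n := by
  refine (Runs.forLt_select (r := 9) rfl rfl rfl rfl h0 rfl
    (fun p => s.arr 7 p < s.arr 6 p) (fun p => p) fun p s' hp hf hr => ?_).mono ?_
    fun s' _ h' => by rwa [h9] at h'
  · have h6 : s'.arr 6 = s.arr 6 := hf.arr 6 rfl
    have h7 : s'.arr 7 = s.arr 7 := hf.arr 7 rfl
    by_cases hb : s.arr 7 p < s.arr 6 p <;> simp [effect, hr, h6, h7, hb]
  · simp only [size]
    lia

open Classical in
theorem runs_remove {d : Bool} (h : Holds I σ s) {R E : Set (Fin n)}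
    (hR : Encodes (s.arr 6) R) (hE : Encodes (s.arr 9) (if d then Eᶜ else E)) :
    Runs T (remove d) s (10 * n + 2) fun s' => Encodes (s'.arr 6) (R ∪ E) := by
  refine (Runs.forLt_map (k := 6) (by cases d <;> rfl) (by cases d <;> rfl)
    (by cases d <;> rfl) rfl h.reg_zero
    (fun p => if (if d then s.arr 9 p < 1 else 0 < s.arr 9 p) then 1 else s.arr 6 p)
    fun p s' hp hf hr hi => ?_).mono ?_ fun s' _ h' i => ?_
  · have h1 : s'.reg 1 = 0 := (hf.reg 1 (by cases d <;> rfl)).trans h.reg_one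
    have h2 : s'.reg 2 = 1 := (hf.reg 2 (by cases d <;> rfl)).trans h.reg_two
    have h9 : s'.arr 9 = s.arr 9 := hf.arr 9 (by cases d <;> rfl)
    cases d
    · by_cases hb : 0 < s.arr 9 p <;> simp [effect, hr, h1, h2, h9, hb, ← hi]
    · by_cases hb : s.arr 9 p = 0 <;> simp [effect, hr, h2, h9, hb, ← hi]
  · cases d <;> simp only [size, Bool.false_eq_true, if_true, if_false] <;> lia
  · rw [h' i i.2, hR i, hE i]
    cases d <;> by_cases h1 : i ∈ R <;> by_cases h2 : i ∈ E <;> simp [h1, h2]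

theorem Game.hits_insert {D : Set (Fin n)} {j i : Fin n} {a : Fin (G.numA i)}
    {b : Fin (G.numB i)} : G.Hits (insert j D) i a b ↔ G.Hits D i a b ∨ 0 < G.P i a b j := by
  constructor
  · rintro ⟨k, rfl | hk, hp⟩
    · exact .inr hp
    · exact .inl ⟨k, hk, hp⟩
  · rintro (⟨k, hk, hp⟩ | hp)
    · exact ⟨k, .inr hk, hp⟩
    · exact ⟨j, .inl rfl, hp⟩

theorem runs_mark_insert (hT : HoldsTransitions T G) {y : ℕ} {j : Fin n} {D : Set (Fin n)}
    (h : Holds I σ s) (hj : s.reg y = j) (hy4 : Nat.beq 4 y = false) (hy5 : Nat.beq 5 y = false)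
    (hD : EncodesRows (s.arr 5) (G.Hits D)) :
    Runs T (mark y) s (10 * G.m₂ + 2) fun s' => EncodesRows (s'.arr 5) (G.Hits (insert j D)) := by
  refine (runs_mark h hj hy4 hy5 hD).mono le_rfl fun s' _ h' i a b => ?_
  rw [h' i a b]
  refine ite_one_zero_congr ?_
  simp only [Game.hits_insert, hT i a b j]

/-- `maxMeets` or `minMeets`. -/
def LoopState.meets (σ : LoopState G) (d : Bool) : Set (Fin n) → Set (Fin n) :=
  if d then σ.maxMeets else σ.minMeets

theorem LoopState.meets_mono (d : Bool) : Monotone (σ.meets d) := by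
  cases d
  exacts [σ.minMeets_mono, σ.maxMeets_mono]

/-- One routine serves both closures: it yields `minMeets` directly and `maxMeets` up to a
complement, which `remove` undoes. -/
theorem LoopState.setOf_not_exists_hits (d : Bool) (D : Set (Fin n)) :
    {i | ∃ a ∈ σ.A i, ¬ ∃ b, (G.Hits D i a b ↔ d = true)} =
      if d then (σ.meets d D)ᶜ else σ.meets d D := by
  ext i
  cases d <;> simp [meets, minMeets, maxMeets]

theorem Game.not_hits_empty {i : Fin n} {a : Fin (G.numA i)} {b : Fin (G.numB i)} :
    ¬ G.Hits ∅ i a b := fun ⟨_, hj, _⟩ => hj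

theorem runs_clear_rows (h : Holds I σ s) :
    Runs T (clear 5 3) s (3 * G.m₂ + 2) fun s' => EncodesRows (s'.arr 5) (G.Hits ∅) :=
  (runs_clear h.reg_three h.reg_one rfl).mono le_rfl fun s' _ h' i a b => by
    rw [h' _ (tripleIndex_lt i a b), if_neg Game.not_hits_empty]

open Classical in
-- Worklist algorithm: `D` is the set of processed states and `R'` the current set, with `meets d D
-- ⊆ R'`. Each of the `n` passes enlarges `D` or finds `D = R'`; after `n` passes `D = R'` in either
-- case, so `R'` is closed. The hypothesis `h0` is this inclusion for `D = ∅`.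
theorem runs_close (hT : HoldsTransitions T G) {d : Bool} (hn : 0 < n) (h : Holds I σ s)
    {R : Set (Fin n)} (hR : Encodes (s.arr 6) R) (h0 : σ.meets d ∅ ⊆ R) :
    Runs T (close d) s (120 * (n * G.m₂)) fun s' =>
      Encodes (s'.arr 6) (leastClosed (σ.meets d) R) := by
  have hM : n ≤ G.m₂ := le_m₂
  set L := leastClosed (σ.meets d) R with hL
  refine Runs.mono (B := 3 * n + 2 + (3 * G.m₂ + 2 + (n * (90 * G.m₂ + 2) + 2)))
    (Runs.seq (runs_clear h.reg_zero h.reg_one rfl) fun s₁ f₁ q₁ => ?_) ?_ fun _ _ h => h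
  swap
  · have := Nat.le_mul_of_pos_left G.m₂ hn
    nlinarith
  have k₁ := h.frame f₁ rfl
  refine Runs.seq (runs_clear_rows k₁) fun s₂ f₂ q₂ => ?_
  have k₂ := k₁.frame f₂ rfl
  refine (Runs.forLt_const (by cases d <;> rfl) (by cases d <;> rfl) rfl k₂.reg_zero
    (fun k s' => ∃ D R' : Set (Fin n), Encodes (s'.arr 7) D ∧ Encodes (s'.arr 6) R' ∧
      EncodesRows (s'.arr 5) (G.Hits D) ∧ D ⊆ R' ∧ R ⊆ R' ∧ R' ⊆ L ∧ σ.meets d D ⊆ R' ∧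
      (k ≤ D.ncard ∨ D = R')) ?_ ?_).mono le_rfl ?_
  · refine ⟨∅, R, fun i => ?_, ?_, q₂, Set.empty_subset _, le_rfl, subset_leastClosed, h0,
      .inl (Nat.zero_le _)⟩
    · rw [Memory.setReg_arr, f₂.arr 7 rfl, q₁ i i.2, if_neg (Set.notMem_empty i)]
    · rwa [Memory.setReg_arr, f₂.arr 6 rfl, f₁.arr 6 rfl]
  · rintro k s₃ hk f₃ - ⟨D, R', hD, hR', hrows, hDR', hRR', hR'L, hclosed, hcard⟩
    have k₃ := k₂.frame f₃ (by cases d <;> rfl)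
    refine Runs.mono (B := 1 + (10 * n + 2 +
      (1 + (10 * G.m₂ + 2 + (40 * G.m₂ + (10 * n + 2))) + 1)))
      (Runs.seq (Runs.of_loopFree rfl
        (Q := fun s' => s' = (Program.copy 9 0).effect T s₃) rfl) ?_) (by lia) fun _ _ h => h
    rintro s₄ f₄ rfl
    have k₄ := k₃.frame f₄ rfl
    -- The value `n`, which is no state, signals that nothing is left to process.
    have h9 : ((Program.copy 9 0).effect T s₃).reg 9 = n := by simp [effect, k₃.reg_zero]
    refine Runs.seq (runs_pick k₄.reg_zero h9) fun s₅ f₅ q₅ => ?_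
    have k₅ := k₄.frame f₅ rfl
    have a7 : s₅.arr 7 = s₃.arr 7 := f₅.arr 7 rfl
    have a6 : s₅.arr 6 = s₃.arr 6 := f₅.arr 6 rfl
    have a5 : s₅.arr 5 = s₃.arr 5 := f₅.arr 5 rfl
    simp only [effect, Memory.setReg_arr] at q₅
    have hlt : ∀ i : Fin n, s₃.arr 7 i < s₃.arr 6 i ↔ i ∈ R' ∧ i ∉ D := by
      intro i
      rw [hD i, hR' i]
      by_cases h1 : i ∈ R' <;> by_cases h2 : i ∈ D <;> simp [h1, h2]
    refine Runs.ifLt (fun hlt' => ?_) fun hlt' => ?_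
    · obtain ⟨j, hjR, hjD, hj⟩ : ∃ j : Fin n, j ∈ R' ∧ j ∉ D ∧ s₅.reg 9 = j := by
        rcases q₅ with ⟨p, hp, h1, h2⟩ | ⟨-, h2⟩
        · exact ⟨⟨p, hp⟩, ((hlt ⟨p, hp⟩).1 h1).1, ((hlt ⟨p, hp⟩).1 h1).2, h2⟩
        · rw [h2, k₅.reg_zero] at hlt'
          exact (lt_irrefl _ hlt').elim
      refine Runs.seq (Runs.of_loopFree rfl
        (Q := fun s' => s' = (Program.store 7 9 2).effect T s₅) rfl) ?_
      rintro s₆ f₆ rfl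
      have k₆ := k₅.frame f₆ rfl
      set s₆ := (Program.store 7 9 2).effect T s₅ with hs₆
      have hD6 : Encodes (s₆.arr 7) (insert j D) := by
        intro i
        simp only [hs₆, effect, hj, k₅.reg_two, Memory.setArr_arr, Function.update_self, a7]
        by_cases hij : i = j
        · simp [hij]
        · rw [Function.update_of_ne (fun h => hij (Fin.ext h)), hD i]
          simp [hij]
      refine Runs.seq (runs_mark_insert hT k₆ (j := j) (D := D) ?_ rfl rfl ?_) fun s₇ f₇ q₇ => ?_
      · exact (f₆.reg 9 rfl).trans hj
      · rwa [f₆.arr 5 rfl, a5]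
      have k₇ := k₆.frame f₇ rfl
      refine Runs.seq (runs_assess (d := d) hn k₇ q₇) fun s₈ f₈ q₈ => ?_
      have k₈ := k₇.frame f₈ (by cases d <;> rfl)
      have q₈' := q₈.2
      rw [LoopState.setOf_not_exists_hits] at q₈'
      refine (runs_remove k₈ (R := R') ?_ q₈').mono le_rfl fun s₉ f₉ q₉ => ?_
      · rwa [f₈.arr 6 (by cases d <;> rfl), f₇.arr 6 rfl, f₆.arr 6 rfl, a6]
      refine ⟨insert j D, R' ∪ σ.meets d (insert j D), ?_, q₉, ?_, ?_, ?_, ?_, ?_, ?_⟩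
      · rwa [Memory.setReg_arr, f₉.arr 7 (by cases d <;> rfl), f₈.arr 7 (by cases d <;> rfl),
          f₇.arr 7 rfl]
      · rwa [Memory.setReg_arr, f₉.arr 5 (by cases d <;> rfl), f₈.arr 5 (by cases d <;> rfl)]
      · exact (Set.insert_subset hjR hDR').trans Set.subset_union_left
      · exact hRR'.trans Set.subset_union_left
      · refine Set.union_subset hR'L ((LoopState.meets_mono d ?_).trans
          (map_leastClosed_subset (LoopState.meets_mono d)))
        exact (Set.insert_subset hjR hDR').trans hR'L
      · exact Set.subset_union_right
      · left
        rw [Set.ncard_insert_of_notMem hjD]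
        exact Nat.succ_le_succ (hcard.resolve_right fun h => hjD (h ▸ hjR))
    · refine (Runs.of_loopFree (c := .skip) rfl (Q := fun s' => s' = s₅) rfl).mono (by simp only [size]; lia) ?_
      rintro _ - rfl
      refine ⟨D, R', ?_, ?_, ?_, hDR', hRR', hR'L, hclosed, .inr (hDR'.antisymm fun i hi => ?_)⟩
      · rwa [Memory.setReg_arr, a7]
      · rwa [Memory.setReg_arr, a6]
      · rwa [Memory.setReg_arr, a5]
      · rcases q₅ with ⟨p, hp, -, h2⟩ | ⟨h1, -⟩
        · rw [h2, k₅.reg_zero] at hlt'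
          exact (hlt' hp).elim
        · by_contra hiD
          exact h1 i i.2 ((hlt i).2 ⟨hi, hiD⟩)
  · rintro s' - ⟨D, R', -, hR', -, hDR', hRR', hR'L, hclosed, hcard⟩
    have hDR : D = R' := by
      refine hcard.elim (fun hc => ?_) id
      have : D = Set.univ := Set.eq_of_subset_of_ncard_le (Set.subset_univ _) (by
        rw [Set.ncard_univ, Nat.card_eq_fintype_card, Fintype.card_fin]
        exact hc)
      exact hDR'.antisymm (this ▸ Set.subset_univ _)
    subst hDR
    have : L = D := (leastClosed_subset hRR' hclosed).antisymm hR'L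
    rwa [this]

open Classical in
theorem runs_markAll (hT : HoldsTransitions T G) (hn : 0 < n) (h : Holds I σ s) {D : Set (Fin n)}
    (hD : Encodes (s.arr 6) D) :
    Runs T markAll s (30 * (n * G.m₂)) fun s' => EncodesRows (s'.arr 5) (G.Hits D) := by
  have hM : n ≤ G.m₂ := le_m₂
  refine Runs.mono (B := 3 * G.m₂ + 2 + (n * (10 * G.m₂ + 4 + 2) + 2))
    (Runs.seq (runs_clear_rows h) fun s₁ f₁ q₁ => ?_) ?_ fun _ _ h => h
  swap
  · have := Nat.le_mul_of_pos_left G.m₂ hn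
    nlinarith
  have k₁ := h.frame f₁ rfl
  refine (Runs.forLt_const rfl rfl rfl k₁.reg_zero
    (fun k s' => EncodesRows (s'.arr 5) (G.Hits {j | j ∈ D ∧ (j : ℕ) < k})) ?_ ?_).mono le_rfl ?_
  · simpa using q₁
  · rintro k s₂ hk f₂ hr q₂
    have k₂ := k₁.frame f₂ rfl
    refine Runs.mono (B := 1 + (10 * G.m₂ + 2 + 1)) (Runs.seq (Runs.of_loopFree rfl
        (Q := fun s' => s' = (Program.load 5 6 10).effect T s₂) rfl) ?_) (by lia) fun _ _ h => h
    rintro s₃ f₃ rfl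
    have k₃ := k₂.frame f₃ rfl
    have h6 : s₂.arr 6 k = if (⟨k, hk⟩ : Fin n) ∈ D then 1 else 0 := by
      rw [f₂.arr 6 rfl, f₁.arr 6 rfl]
      exact hD ⟨k, hk⟩
    have h5 : ((Program.load 5 6 10).effect T s₂).reg 5 = if (⟨k, hk⟩ : Fin n) ∈ D then 1 else 0 := by
      simpa [effect, hr] using h6
    refine Runs.ifLt (B := 10 * G.m₂ + 2) (fun hlt => ?_) fun hlt => ?_
    · rw [h5, k₃.reg_one] at hlt
      have hkD : (⟨k, hk⟩ : Fin n) ∈ D := by_contra fun h => by simp [h] at hlt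
      refine (runs_mark_insert hT k₃ (j := ⟨k, hk⟩)
        ((f₃.reg 10 rfl).trans hr) rfl rfl q₂).mono le_rfl fun s' _ q => ?_
      have : {j : Fin n | j ∈ D ∧ (j : ℕ) < k + 1} = insert ⟨k, hk⟩ {j | j ∈ D ∧ (j : ℕ) < k} := by
        ext j
        simp only [Set.mem_insert_iff, Set.mem_ofPred_eq, Fin.ext_iff]
        constructor
        · rintro ⟨h1, h2⟩
          rcases Nat.lt_succ_iff_lt_or_eq.1 h2 with h3 | h3
          exacts [.inr ⟨h1, h3⟩, .inl h3]
        · rintro (h1 | ⟨h1, h2⟩)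
          · exact ⟨by rwa [show j = ⟨k, hk⟩ from Fin.ext h1], by lia⟩
          · exact ⟨h1, by lia⟩
      rw [this]
      exact q
    · rw [h5, k₃.reg_one] at hlt
      have hkD : (⟨k, hk⟩ : Fin n) ∉ D := fun h => by simp [h] at hlt
      refine (Runs.of_loopFree (c := .skip) rfl
        (Q := fun s' => s' = (Program.load 5 6 10).effect T s₂) rfl).mono (by simp only [size]; lia) ?_
      rintro _ - rfl
      have : {j : Fin n | j ∈ D ∧ (j : ℕ) < k + 1} = {j | j ∈ D ∧ (j : ℕ) < k} := by
        ext j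
        simp only [Set.mem_ofPred_eq]
        refine and_congr_right fun h1 => ⟨fun h2 => ?_, fun h2 => by lia⟩
        rcases Nat.lt_succ_iff_lt_or_eq.1 h2 with h3 | rfl
        exacts [h3, (hkD h1).elim]
      rw [this]
      exact q₂
  · intro s' _ q
    simpa using q

end Routines

namespace Runs

variable {T : ℕ → ℕ → ℝ} {c d : Program} {s : Memory} {B : ℕ} {Q : Memory → Prop}

theorem loopFree_seq (hc : c.loopFree = true)
    (h : Frame c s (c.effect T s) → Runs T d (c.effect T s) B Q) :
    Runs T (.seq c d) s (c.size + B) Q := by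
  refine seq (of_loopFree hc (Q := fun s' => s' = c.effect T s) rfl) ?_
  rintro _ hf rfl
  exact h hf

open Classical in
/-- A loop that sets a register if some index has a certain property. -/
theorem forLt_flag {x y N r v : ℕ} (hc : c.loopFree = true) (hx : c.writes x = false)
    (hy : c.writes y = false) (hxy : Nat.beq x y = false) (hN : s.reg y = N)
    (hxr : Nat.beq x r = false) (φ : ℕ → Prop)
    (step : ∀ p s', p < N → Frame (.forLt x y c) s s' → s'.reg x = p →
      (c.effect T s').reg r = if φ p then v else s'.reg r) :
    Runs T (.forLt x y c) s (N * (c.size + 2) + 2) fun s' =>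
      s'.reg r = if ∃ p < N, φ p then v else s.reg r := by
  refine (forLt_select hc hx hy hxy hN hxr φ (fun _ => v) step).mono le_rfl fun s' _ h => ?_
  rcases h with ⟨p, hp, h1, h2⟩ | ⟨h1, h2⟩
  · rw [h2, if_pos ⟨p, hp, h1⟩]
  · rw [h2, if_neg (by simpa using h1)]

/-- Amortized bound: a pass for state `i` may take time proportional to its number of triples, and
these numbers add up to `m₂`. -/
theorem forLt_states {n : ℕ} {G : Game n} {x y : ℕ} (hx : c.writes x = false)
    (hy : c.writes y = false) (hxy : Nat.beq x y = false) (hN : s.reg y = n)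
    (Inv : ℕ → Memory → Prop) (h0 : Inv 0 (s.setReg x 0))
    (step : ∀ (i : Fin n) s', Frame (.forLt x y c) s s' → s'.reg x = i → Inv i s' →
      Runs T c s' (B * (G.numA i * G.numB i)) fun s'' => Inv (i + 1) (s''.setReg x (i + 1))) :
    Runs T (.forLt x y c) s ((B + 2) * G.m₂ + 2) (Inv n) := by
  refine (forLt hx hy hxy hN Inv
    (fun k => if h : k < n then B * (G.numA ⟨k, h⟩ * G.numB ⟨k, h⟩) else 0) h0
    fun k s' hk hf hr hi => ?_).mono ?_ fun _ _ h => h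
  · rw [dif_pos hk]
    exact step ⟨k, hk⟩ s' hf hr hi
  · rw [← Fin.sum_univ_eq_sum_range
      (fun k => (if h : k < n then B * (G.numA ⟨k, h⟩ * G.numB ⟨k, h⟩) else 0) + 2)]
    refine Nat.add_le_add_right ?_ 2
    rw [Game.m₂, Finset.mul_sum]
    refine Finset.sum_le_sum fun i _ => ?_
    have := Nat.mul_pos (G.numA_pos i) (G.numB_pos i)
    simp only [i.2, dif_pos, Fin.eta]
    nlinarith

end Runs

/-! ### Initialization and output -/

/-- Print the loop variables. -/
def printState : Program :=
  .seq (.forLt 4 0 (.seq (.load 5 3 4) (.print 5))) (.seq (.const 15 0)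
    (.forLt 4 0 (.seq (.load 16 0 4) (.seq (.load 17 1 4)
      (.forLt 18 16 (.seq (.load 5 4 15) (.seq (.print 5) (.forLt 19 17 (.inc 15)))))))))

/-- Set up the constants, the loop variables and the arrays that describe the triples. -/
def setUp : Program :=
  .seq (.const 2 1) (.seq (.const 3 0)
    (.forLt 4 0 (.seq (.store 3 4 2) (.seq (.load 16 0 4) (.seq (.load 17 1 4)
      (.forLt 18 16 (.seq (.copy 15 3)
        (.forLt 19 17 (.seq (.store 12 3 4) (.seq (.store 13 3 15)
          (.seq (.store 4 3 2) (.inc 3))))))))))))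

section Routines

variable {n : ℕ} {G : Game n} {I : Finset (Fin n)} {σ : LoopState G} {s : Memory}
  {T : ℕ → ℕ → ℝ}

theorem take_finRange_succ {m : ℕ} (k : Fin m) :
    (List.finRange m).take (k + 1) = (List.finRange m).take k ++ [k] := by
  rw [List.take_succ_eq_append_getElem (by simp)]
  simp

/-- Register `15` points to the first row of the pair to be printed. In the absence of addition it
is advanced by counting up to `|B_i|`, which is still `O(m₂)` altogether. -/
theorem runs_printState (h : Holds I σ s) :
    Runs T printState s (30 * G.m₂ + 10) fun s' => s'.out = s.out ++ σ.code := by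
  classical
  have hM : n ≤ G.m₂ := le_m₂
  refine Runs.mono (B := n * (2 + 2) + 2 + (1 + ((20 + 2) * G.m₂ + 2))) (Runs.seq
    (Runs.forLt_loopFree rfl rfl rfl rfl h.reg_zero (fun k s' => s'.out = s.out ++
      ((List.finRange n).take k).map fun i => if i ∈ σ.S then 1 else 0) (by simp)
      fun k s' hk hf hr hi => ?_) fun s₁ f₁ q₁ => Runs.loopFree_seq rfl fun f₂ => ?_)
    (by lia) fun _ _ h => h
  · have h3 : s'.arr 3 k = if (⟨k, hk⟩ : Fin n) ∈ σ.S then 1 else 0 := by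
      rw [hf.arr 3 rfl]
      exact (h.states ⟨k, hk⟩).trans (ite_one_zero_congr Iff.rfl)
    have := take_finRange_succ (⟨k, hk⟩ : Fin n)
    simp only at this
    rw [this]
    simp [effect, hi, hr, h3]
  have k₁ := h.frame f₁ rfl
  have k₂ := k₁.frame f₂ rfl
  refine (Runs.forLt_states (G := G) rfl rfl rfl k₂.reg_zero
    (fun k s' => s'.reg 15 = baseIndex G k ∧ s'.out = s₁.out ++
      ((List.finRange n).take k).flatMap fun i =>
        (List.finRange (G.numA i)).map fun a => if a ∈ σ.A i then 1 else 0) ?_ ?_).mono le_rfl ?_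
  · simp [effect, baseIndex_zero]
  · rintro i s₃ f₃ hr ⟨h15, hout⟩
    have k₃ := k₂.frame f₃ rfl
    have hA := G.numA_pos i
    have hB := G.numB_pos i
    refine Runs.mono (B := 1 + (1 + (G.numA i * (1 + (1 + (G.numB i * (1 + 2) + 2)) + 2) + 2)))
      (Runs.loopFree_seq rfl fun f₄ => Runs.loopFree_seq rfl fun f₅ => ?_) (by nlinarith)
      fun _ _ h => h
    set s₄ := (Program.load 16 0 4).effect T s₃ with hs₄
    set s₅ := (Program.load 17 1 4).effect T s₄ with hs₅
    have k₅ := (k₃.frame f₄ rfl).frame f₅ rfl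
    have h16 : s₅.reg 16 = G.numA i := by simp [hs₅, hs₄, effect, hr, k₃.numA]
    have h17 : s₅.reg 17 = G.numB i := by simp [hs₅, hs₄, effect, hr, k₃.numB]
    refine (Runs.forLt_const rfl rfl rfl h16
      (fun k s' => s'.reg 15 = baseIndex G i + k * G.numB i ∧ s'.out = s₅.out ++
        ((List.finRange (G.numA i)).take k).map fun a => if a ∈ σ.A i then 1 else 0)
      ?_ ?_).mono le_rfl ?_
    · simp [hs₅, hs₄, effect, h15]
    · rintro k s₆ hk f₆ - ⟨h15, hout⟩
      have k₆ := k₅.frame f₆ rfl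
      refine Runs.loopFree_seq rfl fun f₇ => Runs.loopFree_seq rfl fun f₈ => ?_
      set s₇ := (Program.load 5 4 15).effect T s₆ with hs₇
      set s₈ := (Program.print 5).effect T s₇ with hs₈
      have h5 : s₇.reg 5 = if (⟨k, hk⟩ : Fin (G.numA i)) ∈ σ.A i then 1 else 0 := by
        have := k₆.actions i ⟨k, hk⟩ 0
        rw [show tripleIndex G i ⟨k, hk⟩ 0 = baseIndex G i + k * G.numB i from
          pairIndex_eq i ⟨k, hk⟩] at this
        simp only [hs₇, effect, Memory.setReg_reg, Function.update_self, h15, this]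
        exact ite_one_zero_congr Iff.rfl
      have h17' : s₈.reg 17 = G.numB i := by
        rw [f₈.reg 17 rfl, f₇.reg 17 rfl, f₆.reg 17 rfl, h17]
      have h15' : s₈.reg 15 = baseIndex G i + k * G.numB i := by
        rw [f₈.reg 15 rfl, f₇.reg 15 rfl, h15]
      refine (Runs.forLt_loopFree rfl rfl rfl rfl h17'
        (fun b s' => s'.reg 15 = baseIndex G i + k * G.numB i + b) (by simp [h15'])
        fun b s' _ _ _ hb => ?_).mono le_rfl fun s₉ f₉ q₉ => ?_
      · simp [effect, hb, add_assoc]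
      · constructor
        · simp only [Memory.setReg_reg]
          rw [Function.update_of_ne (by decide), q₉]
          ring
        · have := take_finRange_succ (⟨k, hk⟩ : Fin (G.numA i))
          simp only at this
          rw [this, Memory.setReg_out, f₉.out rfl]
          simp [hs₈, effect, f₇.out rfl, hout, h5]
    · rintro s₆ - ⟨h15, hout⟩
      constructor
      · simp only [Memory.setReg_reg]
        rw [Function.update_of_ne (by decide), h15, baseIndex_succ]
      · have hout' : s₅.out = s₃.out := (f₅.out rfl).trans (f₄.out rfl)
        rw [take_finRange_succ, Memory.setReg_out, hout, hout', List.take_of_length_le (by simp)]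
        simp [*]
  · rintro s' - ⟨-, hout⟩
    rw [hout, q₁, List.take_of_length_le (by simp),
      LoopState.code, List.append_assoc]

theorem holds_of_setUp {s : Memory} (h0 : s.reg 0 = n) (h1 : s.reg 1 = 0) (h2 : s.reg 2 = 1)
    (h3 : s.reg 3 = G.m₂) (a0 : s.arr 0 = (initialMemory G I).arr 0)
    (a1 : s.arr 1 = (initialMemory G I).arr 1) (a2 : s.arr 2 = (initialMemory G I).arr 2)
    (hS : ∀ i : Fin n, s.arr 3 i = 1)
    (hrows : ∀ i a b, s.arr 12 (tripleIndex G i a b) = i ∧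
      s.arr 13 (tripleIndex G i a b) = pairIndex i a ∧ s.arr 4 (tripleIndex G i a b) = 1) :
    Holds I (LoopState.full G) s where
  reg_zero := h0
  reg_one := h1
  reg_two := h2
  reg_three := h3
  numA i := by simp [a0, initialMemory]
  numB i := by simp [a1, initialMemory]
  target i := by simp [a2, initialMemory]
  state i a b := (hrows i a b).1
  pair i a b := (hrows i a b).2.1
  states i := by simp [hS, LoopState.full]
  actions i a b := by simp [(hrows i a b).2.2, LoopState.full]

theorem runs_setUp :
    Runs T setUp (initialMemory G I) (30 * G.m₂ + 10) (Holds I (LoopState.full G)) := by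
  classical
  have hM : n ≤ G.m₂ := le_m₂
  refine Runs.mono (B := 1 + (1 + ((20 + 2) * G.m₂ + 2)))
    (Runs.loopFree_seq rfl fun f₁ => Runs.loopFree_seq rfl fun f₂ => ?_) (by lia) fun _ _ h => h
  set s₁ := (Program.const 2 1).effect T (initialMemory G I) with hs₁
  set s₂ := (Program.const 3 0).effect T s₁ with hs₂
  have h0 : s₂.reg 0 = n := by simp [hs₂, hs₁, effect, initialMemory]
  have h1 : s₂.reg 1 = 0 := by simp [hs₂, hs₁, effect, initialMemory]
  have h2 : s₂.reg 2 = 1 := by simp [hs₂, hs₁, effect]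
  -- Register `3` counts the rows already written, so it ends up with the value `m₂` without any
  -- multiplication.
  let W : Memory → ℕ → Prop := fun s' p => s'.reg 3 = p ∧ ∀ i a b, tripleIndex G i a b < p →
    s'.arr 12 (tripleIndex G i a b) = i ∧ s'.arr 13 (tripleIndex G i a b) = pairIndex i a ∧
      s'.arr 4 (tripleIndex G i a b) = 1
  refine (Runs.forLt_states (G := G) rfl rfl rfl h0
    (fun k s' => W s' (baseIndex G k) ∧ ∀ i : Fin n, (i : ℕ) < k → s'.arr 3 i = 1)
    ?_ ?_).mono le_rfl ?_
  · exact ⟨⟨by simp [hs₂, effect, baseIndex_zero], by simp [baseIndex_zero]⟩, by simp⟩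
  · rintro i s₃ f₃ hr ⟨hW, hS⟩
    have hA := G.numA_pos i
    have hB := G.numB_pos i
    refine Runs.mono
      (B := 1 + (1 + (1 + (G.numA i * (1 + (G.numB i * (4 + 2) + 2) + 2) + 2))))
      (Runs.loopFree_seq rfl fun f₄ => Runs.loopFree_seq rfl fun f₅ =>
        Runs.loopFree_seq rfl fun f₆ => ?_) (by nlinarith) fun _ _ h => h
    set s₄ := (Program.store 3 4 2).effect T s₃ with hs₄
    set s₅ := (Program.load 16 0 4).effect T s₄ with hs₅
    set s₆ := (Program.load 17 1 4).effect T s₅ with hs₆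
    have a0 : s₃.arr 0 i = G.numA i := by
      rw [f₃.arr 0 rfl, f₂.arr 0 rfl, f₁.arr 0 rfl]
      simp [initialMemory]
    have a1 : s₃.arr 1 i = G.numB i := by
      rw [f₃.arr 1 rfl, f₂.arr 1 rfl, f₁.arr 1 rfl]
      simp [initialMemory]
    have r2 : s₃.reg 2 = 1 := by rw [f₃.reg 2 rfl, h2]
    have r2' : s₆.reg 2 = 1 := by rw [f₆.reg 2 rfl, f₅.reg 2 rfl, f₄.reg 2 rfl, r2]
    have r4 : s₆.reg 4 = i := by rw [f₆.reg 4 rfl, f₅.reg 4 rfl, f₄.reg 4 rfl, hr]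
    have h16 : s₆.reg 16 = G.numA i := by simp [hs₆, hs₅, hs₄, effect, hr, a0]
    have h17 : s₆.reg 17 = G.numB i := by simp [hs₆, hs₅, hs₄, effect, hr, a1]
    have hS6 : ∀ j : Fin n, (j : ℕ) < i + 1 → s₆.arr 3 j = 1 := by
      intro j hj
      rw [f₆.arr 3 rfl, f₅.arr 3 rfl]
      simp only [hs₄, effect, Memory.setArr_arr, Function.update_self, hr, r2]
      by_cases hji : (j : ℕ) = i
      · rw [hji, Function.update_self]
      · rw [Function.update_of_ne hji]
        exact hS j (by lia)
    have hW6 : W s₆ (baseIndex G i) := by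
      refine ⟨?_, ?_⟩
      · rw [f₆.reg 3 rfl, f₅.reg 3 rfl, f₄.reg 3 rfl, hW.1]
      · rw [f₆.arr 12 rfl, f₅.arr 12 rfl, f₄.arr 12 rfl, f₆.arr 13 rfl, f₅.arr 13 rfl,
          f₄.arr 13 rfl, f₆.arr 4 rfl, f₅.arr 4 rfl, f₄.arr 4 rfl]
        exact hW.2
    refine (Runs.forLt_const rfl rfl rfl h16
      (fun k s' => W s' (baseIndex G i + k * G.numB i)) ?_ ?_).mono le_rfl ?_
    · simpa [W] using hW6
    · rintro k s₇ hk f₇ - hW7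
      refine Runs.loopFree_seq rfl fun f₈ => ?_
      set s₈ := (Program.copy 15 3).effect T s₇ with hs₈
      have r15 : s₈.reg 15 = pairIndex i (⟨k, hk⟩ : Fin (G.numA i)) := by
        simp [hs₈, effect, hW7.1, pairIndex_eq]
      have h17' : s₈.reg 17 = G.numB i := by rw [f₈.reg 17 rfl, f₇.reg 17 rfl, h17]
      have hW8 : W s₈ (baseIndex G i + k * G.numB i) := by
        refine ⟨?_, ?_⟩
        · rw [f₈.reg 3 rfl, hW7.1]
        · rw [f₈.arr 12 rfl, f₈.arr 13 rfl, f₈.arr 4 rfl]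
          exact hW7.2
      refine (Runs.forLt_loopFree rfl rfl rfl rfl h17'
        (fun b s' => W s' (baseIndex G i + (k * G.numB i + b))) ?_ ?_).mono le_rfl ?_
      · simpa [W] using hW8
      · intro b s₉ hb f₉ _ hW9
        have r15' : s₉.reg 15 = pairIndex i (⟨k, hk⟩ : Fin (G.numA i)) := by
          rw [f₉.reg 15 rfl, r15]
        have r4' : s₉.reg 4 = i := by rw [f₉.reg 4 rfl, f₈.reg 4 rfl, f₇.reg 4 rfl, r4]
        have r2'' : s₉.reg 2 = 1 := by rw [f₉.reg 2 rfl, f₈.reg 2 rfl, f₇.reg 2 rfl, r2']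
        have hidx : baseIndex G i + (k * G.numB i + b) = tripleIndex G i ⟨k, hk⟩ ⟨b, hb⟩ := by
          rw [tripleIndex_eq]
        refine ⟨by simp [effect, hW9.1, add_assoc], fun i' a' b' hlt => ?_⟩
        by_cases he : tripleIndex G i' a' b' = tripleIndex G i ⟨k, hk⟩ ⟨b, hb⟩
        · have := Row.index_injective (G := G) (a₁ := ⟨i', a', b'⟩)
            (a₂ := ⟨i, ⟨k, hk⟩, ⟨b, hb⟩⟩) he
          obtain rfl : i' = i := congrArg Sigma.fst this
          obtain ⟨rfl, rfl⟩ : a' = ⟨k, hk⟩ ∧ b' = ⟨b, hb⟩ := by simpa using this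
          simp [effect, hW9.1, r15', r4', r2'', hidx]
        · have := hW9.2 i' a' b' (by omega)
          simpa [effect, hW9.1, hidx, Function.update_of_ne he] using this
      · intro s' _ hW'
        have : baseIndex G i + (k * G.numB i + G.numB i) = baseIndex G i + (k + 1) * G.numB i := by
          ring
        rw [this] at hW'
        simpa [W] using hW'
    · intro s' f' hW'
      rw [← baseIndex_succ] at hW'
      refine ⟨by simpa [W] using hW', fun j hj => ?_⟩
      rw [Memory.setReg_arr, f'.arr 3 rfl]
      exact hS6 j hj
  · rintro s' f' ⟨hW, hS⟩
    rw [baseIndex_self] at hW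
    refine holds_of_setUp ?_ ?_ ?_ hW.1 ?_ ?_ ?_ (fun i => hS i i.2)
      fun i a b => hW.2 i a b (tripleIndex_lt i a b)
    · rw [f'.reg 0 rfl, h0]
    · rw [f'.reg 1 rfl, h1]
    · rw [f'.reg 2 rfl, h2]
    · rw [f'.arr 0 rfl, f₂.arr 0 rfl, f₁.arr 0 rfl]
    · rw [f'.arr 1 rfl, f₂.arr 1 rfl, f₁.arr 1 rfl]
    · rw [f'.arr 2 rfl, f₂.arr 2 rfl, f₁.arr 2 rfl]

end Routines

/-! ### The tests, the loop body and the whole program -/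

/-- Whether `F⁺(1_{S∖I}) = 1_{S∖I}`, into register `11`. -/
def testSplit : Program :=
  .seq (complement 2 6) (.seq markAll (.seq (assess true) (.seq (.const 11 1)
    (.forLt 4 0 (.seq (.load 5 3 4) (.ifLt 1 5 (.seq (.load 5 9 4) (.seq (.load 6 2 4)
      (.ifLt 5 6 (.const 11 0) (.ifLt 6 5 (.const 11 0) .skip)))) .skip))))))

/-- The complement of `Φ(I)` into the array `6`; whether `Φ(I)` is nonempty, into register `12`. -/
def testOuter : Program :=
  .seq (.forLt 4 0 (.seq (.load 5 2 4) (.store 6 4 5))) (.seq (close false) (.seq (.const 12 0)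
    (.forLt 4 0 (.seq (.load 5 3 4) (.seq (.load 6 6 4) (.ifLt 6 5 (.const 12 1) .skip))))))

/-- The complement of `Φ*(Φ(I))` into the array `6`; whether `Φ*(Φ(I)) = I`, into register `12`. -/
def testClosed : Program :=
  .seq (complement 6 6) (.seq (close true) (.seq (.const 12 1)
    (.forLt 4 0 (.seq (.load 5 6 4) (.seq (.load 6 2 4)
      (.ifLt 5 6 .skip (.ifLt 6 5 .skip (.const 12 0))))))))

/-- The assignments of the loop. -/
def shrink : Program :=
  .seq markAll (.seq (assess true) (.seq (complement 6 3)
    (.forLt 4 3 (.seq (.load 6 13 4) (.seq (.load 5 8 6) (.ifLt 1 5 (.store 4 4 1) .skip))))))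

/-- Leave the loop and return `k`. -/
def finish (k : ℕ) : Program := .seq (.const 13 0) (.const 14 k)

/-- The body of the loop. -/
def body : Program :=
  .seq printState (.seq testSplit (.seq testOuter (.ifLt 11 2 (finish 0) (.ifLt 12 2 (finish 0)
    (.seq testClosed (.ifLt 1 12 (finish 1) shrink))))))

/-- The whole algorithm. -/
def implementation : Program :=
  .seq setUp (.seq (.const 11 0) (.seq (.const 12 0)
    (.seq (.forLt 4 0 (.seq (.load 5 2 4) (.ifLt 1 5 (.const 12 1) .skip)))
      (.seq (.forLt 4 0 (.seq (.load 5 2 4) (.ifLt 1 5 .skip (.const 11 1))))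
        (.seq (.const 14 0)
          (.seq (.ifLt 1 12 (.ifLt 1 11 (.seq (.const 13 1) (.whileLt 1 13 body)) (.const 14 1))
            .skip) (.print 14)))))))

section Routines

variable {n : ℕ} {G : Game n} {I : Finset (Fin n)} {σ : LoopState G} {s : Memory}
  {T : ℕ → ℕ → ℝ}

theorem exists_lt_iff_fin {p : ℕ → Prop} : (∃ k < n, p k) ↔ ∃ i : Fin n, p i :=
  ⟨fun ⟨k, hk, h⟩ => ⟨⟨k, hk⟩, h⟩, fun ⟨i, h⟩ => ⟨i, i.2, h⟩⟩

open Classical in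
theorem Encodes.pos_iff {f : ℕ → ℕ} {D : Set (Fin n)} (h : Encodes f D) (i : Fin n) :
    0 < f i ↔ i ∈ D := by
  rw [h i]
  split_ifs <;> simp_all

open Classical in
theorem Encodes.eq_iff {f g : ℕ → ℕ} {D E : Set (Fin n)} (h : Encodes f D) (h' : Encodes g E)
    (i : Fin n) : f i = g i ↔ (i ∈ D ↔ i ∈ E) := by
  rw [h i, h' i]
  by_cases h1 : i ∈ D <;> by_cases h2 : i ∈ E <;> simp [h1, h2]

open Classical in
theorem Encodes.lt_iff {f g : ℕ → ℕ} {D E : Set (Fin n)} (h : Encodes f D) (h' : Encodes g E)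
    (i : Fin n) : f i < g i ↔ i ∉ D ∧ i ∈ E := by
  rw [h i, h' i]
  by_cases h1 : i ∈ D <;> by_cases h2 : i ∈ E <;> simp [h1, h2]

theorem LoopState.setOf_not_exists_hits_true (D : Set (Fin n)) :
    {i | ∃ a ∈ σ.A i, ¬ ∃ b, (G.Hits D i a b ↔ true = true)} = (σ.maxMeets D)ᶜ :=
  LoopState.setOf_not_exists_hits true D

open Classical in
theorem runs_testSplit (hT : HoldsTransitions T G) (hn : 0 < n) (h : Holds I σ s) :
    Runs T testSplit s (100 * (n * G.m₂)) fun s' =>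
      s'.reg 11 = if ∀ i ∈ σ.S, i ∈ σ.maxMeets (↑I)ᶜ ↔ i ∉ I then 1 else 0 := by
  have hM : n ≤ G.m₂ := le_m₂
  have hnM := Nat.le_mul_of_pos_left G.m₂ hn
  refine Runs.mono (B := 10 * n + 2 + (30 * (n * G.m₂) + (40 * G.m₂ + (1 + (n * (7 + 2) + 2)))))
    (Runs.seq (runs_complement h h.target (.inr rfl)) fun s₁ f₁ q₁ => ?_) (by lia)
    fun _ _ h => h
  have k₁ := h.frame f₁ rfl
  refine Runs.seq (runs_markAll hT hn k₁ q₁) fun s₂ f₂ q₂ => ?_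
  have k₂ := k₁.frame f₂ rfl
  refine Runs.seq (runs_assess (d := true) hn k₂ q₂) fun s₃ f₃ q₃ => ?_
  have k₃ := k₂.frame f₃ rfl
  refine Runs.loopFree_seq rfl fun f₄ => ?_
  set s₄ := (Program.const 11 1).effect T s₃ with hs₄
  have k₄ := k₃.frame f₄ rfl
  have q₄ : Encodes (s₄.arr 9) (σ.maxMeets (↑I)ᶜ)ᶜ := by
    rw [f₄.arr 9 rfl, ← LoopState.setOf_not_exists_hits_true]
    exact q₃.2
  -- Array `9` holds the complement of `maxMeets` of the complement of `I`; on `S` it has to agree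
  -- with `I`.
  refine (Runs.forLt_flag (r := 11) (v := 0) rfl rfl rfl rfl k₄.reg_zero rfl
    (fun p => 0 < s₄.arr 3 p ∧ s₄.arr 9 p ≠ s₄.arr 2 p) fun p s' hp hf hr => ?_).mono
    (by simp [size]) fun s' _ h' => ?_
  · have h1 : s'.reg 1 = 0 := (hf.reg 1 rfl).trans k₄.reg_one
    have h2 : s'.arr 2 = s₄.arr 2 := hf.arr 2 rfl
    have h3 : s'.arr 3 = s₄.arr 3 := hf.arr 3 rfl
    have h9 : s'.arr 9 = s₄.arr 9 := hf.arr 9 rfl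
    by_cases hS : 0 < s₄.arr 3 p
    · rcases lt_trichotomy (s₄.arr 9 p) (s₄.arr 2 p) with hlt | heq | hgt
      · simp [effect, hr, h1, h2, h3, h9, hS, hlt, hlt.ne]
      · simp [effect, hr, h1, h2, h3, h9, hS, heq]
      · simp [effect, hr, h1, h2, h3, h9, hS, hgt, hgt.ne', not_lt_of_gt hgt]
    · simp [effect, hr, h1, h3, hS]
  · have key : (∃ p < n, 0 < s₄.arr 3 p ∧ s₄.arr 9 p ≠ s₄.arr 2 p) ↔
        ¬ ∀ i ∈ σ.S, i ∈ σ.maxMeets (↑I)ᶜ ↔ i ∉ I := by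
      rw [exists_lt_iff_fin]
      simp only [k₄.states.pos_iff, Ne, q₄.eq_iff k₄.target, Finset.mem_coe, Set.mem_compl_iff]
      push Not
      refine exists_congr fun i => and_congr_right fun _ => ?_
      tauto
    rw [h']
    by_cases hc : ∀ i ∈ σ.S, i ∈ σ.maxMeets (↑I)ᶜ ↔ i ∉ I
    · rw [if_neg (by rw [key]; exact not_not.2 hc), if_pos hc]
      simp [hs₄, effect]
    · rw [if_pos (key.2 hc), if_neg hc]

open Classical in
theorem runs_testOuter (hT : HoldsTransitions T G) (hn : 0 < n) (h : Holds I σ s) :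
    Runs T testOuter s (150 * (n * G.m₂)) fun s' =>
      Encodes (s'.arr 6) (σ.outer I) ∧ s'.reg 12 = if ↑σ.S ⊆ σ.outer I then 0 else 1 := by
  have hM : n ≤ G.m₂ := le_m₂
  have hnM := Nat.le_mul_of_pos_left G.m₂ hn
  refine Runs.mono (B := n * (2 + 2) + 2 + (120 * (n * G.m₂) + (1 + (n * (4 + 2) + 2))))
    (Runs.seq (Runs.forLt_map (k := 6) rfl rfl rfl rfl h.reg_zero (fun p => s.arr 2 p)
      fun p s' hp hf hr hi => ?_) fun s₁ f₁ q₁ => ?_) (by lia) fun _ _ h => h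
  · have h2 : s'.arr 2 = s.arr 2 := hf.arr 2 rfl
    simp [effect, hr, h2]
  have k₁ := h.frame f₁ rfl
  have q₁' : Encodes (s₁.arr 6) (I : Set (Fin n)) := fun i => (q₁ i i.2).trans (h.target i)
  refine Runs.seq (runs_close hT (d := false) hn k₁ q₁' ?_) fun s₂ f₂ q₂ => ?_
  · rintro i ⟨a, _, hb⟩
    exact (Game.not_hits_empty (hb 0)).elim
  have k₂ := k₁.frame f₂ rfl
  refine Runs.loopFree_seq rfl fun f₃ => ?_
  set s₃ := (Program.const 12 0).effect T s₂ with hs₃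
  have k₃ := k₂.frame f₃ rfl
  have q₃ : Encodes (s₃.arr 6) (σ.outer I) := by
    rw [f₃.arr 6 rfl]
    exact q₂
  refine (Runs.forLt_flag (r := 12) (v := 1) rfl rfl rfl rfl k₃.reg_zero rfl
    (fun p => s₃.arr 6 p < s₃.arr 3 p) fun p s' hp hf hr => ?_).mono
    (by simp [size]) fun s' f' h' => ⟨?_, ?_⟩
  · have h3 : s'.arr 3 = s₃.arr 3 := hf.arr 3 rfl
    have h6 : s'.arr 6 = s₃.arr 6 := hf.arr 6 rfl
    by_cases hS : s₃.arr 6 p < s₃.arr 3 p <;> simp [effect, hr, h3, h6, hS]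
  · rwa [f'.arr 6 rfl]
  · have key : (∃ p < n, s₃.arr 6 p < s₃.arr 3 p) ↔ ¬ ↑σ.S ⊆ σ.outer I := by
      rw [exists_lt_iff_fin, Set.not_subset]
      simp only [q₃.lt_iff k₃.states]
      exact exists_congr fun i => and_comm
    rw [h']
    by_cases hc : ↑σ.S ⊆ σ.outer I
    · rw [if_neg (by rw [key]; exact not_not.2 hc), if_pos hc]
      simp [hs₃, effect]
    · rw [if_pos (key.2 hc), if_neg hc]

theorem LoopState.Valid.outer_subset (hσ : σ.Valid) (hI : I ⊆ σ.S) : σ.outer I ⊆ σ.S :=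
  leastClosed_subset hI (hσ.minMeets_subset _)

open Classical in
theorem runs_testClosed (hT : HoldsTransitions T G) (hn : 0 < n) (h : Holds I σ s)
    (hσ : σ.Valid) (hI : I ⊆ σ.S) (h6 : Encodes (s.arr 6) (σ.outer I)) :
    Runs T testClosed s (150 * (n * G.m₂)) fun s' =>
      Encodes (s'.arr 6) (σ.escape I) ∧
        s'.reg 12 = if ∀ i, i ∈ I ↔ i ∉ σ.escape I then 1 else 0 := by
  have hM : n ≤ G.m₂ := le_m₂
  have hnM := Nat.le_mul_of_pos_left G.m₂ hn
  refine Runs.mono (B := 10 * n + 2 + (120 * (n * G.m₂) + (1 + (n * (5 + 2) + 2))))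
    (Runs.seq (runs_complement h h6 (.inl rfl)) fun s₁ f₁ q₁ => ?_) (by lia) fun _ _ h => h
  have k₁ := h.frame f₁ rfl
  refine Runs.seq (runs_close hT (d := true) hn k₁ q₁ ?_) fun s₂ f₂ q₂ => ?_
  -- A state in `maxMeets ∅` has no action, so it is not in `S`, while `outer` is contained in `S`.
  · intro i hi hio
    obtain ⟨a, ha⟩ := hσ.nonempty i (hσ.outer_subset hI hio)
    obtain ⟨b, hb⟩ := hi a ha
    exact Game.not_hits_empty hb
  have k₂ := k₁.frame f₂ rfl
  refine Runs.loopFree_seq rfl fun f₃ => ?_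
  set s₃ := (Program.const 12 1).effect T s₂ with hs₃
  have k₃ := k₂.frame f₃ rfl
  have q₃ : Encodes (s₃.arr 6) (σ.escape I) := by
    rw [f₃.arr 6 rfl]
    exact q₂
  refine (Runs.forLt_flag (r := 12) (v := 0) rfl rfl rfl rfl k₃.reg_zero rfl
    (fun p => s₃.arr 6 p = s₃.arr 2 p) fun p s' hp hf hr => ?_).mono
    (by simp [size]) fun s' f' h' => ⟨?_, ?_⟩
  · have h2 : s'.arr 2 = s₃.arr 2 := hf.arr 2 rfl
    have h6 : s'.arr 6 = s₃.arr 6 := hf.arr 6 rfl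
    rcases lt_trichotomy (s₃.arr 6 p) (s₃.arr 2 p) with hlt | heq | hgt
    · simp [effect, hr, h2, h6, hlt, hlt.ne]
    · simp [effect, hr, h2, h6, heq]
    · simp [effect, hr, h2, h6, hgt, hgt.ne', not_lt_of_gt hgt]
  · rwa [f'.arr 6 rfl]
  -- Array `6` holds `escape`, the complement of the closure, so an equal entry, not a different
  -- one, refutes that the closure is `I`.
  · have key : (∃ p < n, s₃.arr 6 p = s₃.arr 2 p) ↔ ¬ ∀ i, i ∈ I ↔ i ∉ σ.escape I := by
      rw [exists_lt_iff_fin, not_forall]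
      simp only [q₃.eq_iff k₃.target, Finset.mem_coe]
      exact exists_congr fun i => by tauto
    rw [h']
    by_cases hc : ∀ i, i ∈ I ↔ i ∉ σ.escape I
    · rw [if_neg (by rw [key]; exact not_not.2 hc), if_pos hc]
      simp [hs₃, effect]
    · rw [if_pos (key.2 hc), if_neg hc]

open Classical in
-- After marking the triples that hit `escape`, array `8` flags the pairs with a marked triple.
-- These are exactly the actions to delete, by `mem_reduce_A`.
theorem runs_shrink (hT : HoldsTransitions T G) (hn : 0 < n) (h : Holds I σ s)
    (hσ : σ.Valid) (h6 : Encodes (s.arr 6) (σ.escape I)) :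
    Runs T shrink s (100 * (n * G.m₂)) (Holds I (σ.reduce I)) := by
  have hM : n ≤ G.m₂ := le_m₂
  have hnM := Nat.le_mul_of_pos_left G.m₂ hn
  refine Runs.mono (B := 30 * (n * G.m₂) + (40 * G.m₂ + (10 * n + 2 + (G.m₂ * (4 + 2) + 2))))
    (Runs.seq (runs_markAll hT hn h h6) fun s₁ f₁ q₁ => ?_) (by lia) fun _ _ h => h
  have k₁ := h.frame f₁ rfl
  refine Runs.seq (runs_assess (d := true) hn k₁ q₁) fun s₂ f₂ q₂ => ?_
  have k₂ := k₁.frame f₂ rfl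
  have h6' : Encodes (s₂.arr 6) (σ.escape I) := by
    rwa [f₂.arr 6 rfl, f₁.arr 6 rfl]
  refine Runs.seq (runs_complement k₂ h6' (.inr rfl)) fun s₃ f₃ q₃ => ?_
  have r1 : s₃.reg 1 = 0 := by rw [f₃.reg 1 rfl, k₂.reg_one]
  have r3 : s₃.reg 3 = G.m₂ := by rw [f₃.reg 3 rfl, k₂.reg_three]
  refine (Runs.forLt_map (k := 4) rfl rfl rfl rfl r3
    (fun p => if 0 < s₃.arr 8 (s₃.arr 13 p) then 0 else s₃.arr 4 p)
    fun p s' hp hf hr hi => ?_).mono (by simp [size]) fun s' f' h' => ?_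
  · have h1 : s'.reg 1 = 0 := by rw [hf.reg 1 rfl, r1]
    have h8 : s'.arr 8 = s₃.arr 8 := hf.arr 8 rfl
    have h13 : s'.arr 13 = s₃.arr 13 := hf.arr 13 rfl
    by_cases hb : 0 < s₃.arr 8 (s₃.arr 13 p) <;> simp [effect, hr, h1, h8, h13, hb, ← hi]
  · constructor
    · rw [f'.reg 0 rfl, f₃.reg 0 rfl, k₂.reg_zero]
    · rw [f'.reg 1 rfl, r1]
    · rw [f'.reg 2 rfl, f₃.reg 2 rfl, k₂.reg_two]
    · rw [f'.reg 3 rfl, r3]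
    · rw [f'.arr 0 rfl, f₃.arr 0 rfl]
      exact k₂.numA
    · rw [f'.arr 1 rfl, f₃.arr 1 rfl]
      exact k₂.numB
    · rw [f'.arr 2 rfl, f₃.arr 2 rfl]
      exact k₂.target
    · rw [f'.arr 12 rfl, f₃.arr 12 rfl]
      exact k₂.state
    · rw [f'.arr 13 rfl, f₃.arr 13 rfl]
      exact k₂.pair
    · rw [f'.arr 3 rfl]
      intro i
      rw [q₃ i]
      exact ite_one_zero_congr hσ.mem_reduce_S.symm
    · intro i a b
      have e8 : s₃.arr 8 (pairIndex i a) = if ∃ b, G.Hits (σ.escape I) i a b then 1 else 0 := by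
        rw [f₃.arr 8 rfl, q₂.1 i a]
        exact ite_one_zero_congr (by simp)
      rw [h' _ (tripleIndex_lt i a b), f₃.arr 13 rfl, k₂.pair, e8, f₃.arr 4 rfl, k₂.actions i a b]
      refine Eq.trans ?_ (ite_one_zero_congr (dp := Classical.propDecidable _)
        hσ.mem_reduce_A.symm)
      by_cases h1 : ∃ b, G.Hits (σ.escape I) i a b
      · have h2 : ¬ ∀ b, ¬ G.Hits (σ.escape I) i a b := by simpa using h1
        simp [h1, h2]
      · have h2 : ∀ b, ¬ G.Hits (σ.escape I) i a b := by simpa using h1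
        simp [h2]

theorem runs_finish {k : ℕ} :
    Runs T (finish k) s 2 fun s' => s'.reg 13 = 0 ∧ s'.reg 14 = k :=
  Runs.of_loopFree rfl (by simp [finish, effect])

/-- The three outcomes match the constructors of `Loop`. Register `13` keeps the loop running and
register `14` is the answer. -/
theorem runs_body (hT : HoldsTransitions T G) (hn : 0 < n) (h : Holds I σ s)
    (hσ : σ.Valid) (hI : I ⊆ σ.S) :
    Runs T body s (600 * (n * G.m₂)) fun s' => s'.out = s.out ++ σ.code ∧
      (σ.Rejects I ∧ s'.reg 13 = 0 ∧ s'.reg 14 = 0 ∨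
        ¬ σ.Rejects I ∧ σ.clo I = σ.sub I ∧ s'.reg 13 = 0 ∧ s'.reg 14 = 1 ∨
        ¬ σ.Rejects I ∧ σ.clo I ≠ σ.sub I ∧ s'.reg 13 = s.reg 13 ∧ Holds I (σ.reduce I) s') := by
  classical
  have hM : n ≤ G.m₂ := le_m₂
  have hnM := Nat.le_mul_of_pos_left G.m₂ hn
  refine Runs.mono (B := 30 * G.m₂ + 10 + (100 * (n * G.m₂) + (150 * (n * G.m₂) +
    (150 * (n * G.m₂) + (100 * (n * G.m₂) + 1) + 1 + 1))))
    (Runs.seq (runs_printState h) fun s₁ f₁ q₁ => ?_) (by lia) fun _ _ h => h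
  have k₁ := h.frame f₁ rfl
  refine Runs.seq (runs_testSplit hT hn k₁) fun s₂ f₂ q₂ => ?_
  have k₂ := k₁.frame f₂ rfl
  refine Runs.seq (runs_testOuter hT hn k₂) fun s₃ f₃ q₃ => ?_
  have k₃ := k₂.frame f₃ rfl
  have o₃ : s₃.out = s.out ++ σ.code := by rw [f₃.out rfl, f₂.out rfl, q₁]
  have r11 : s₃.reg 11 < s₃.reg 2 ↔ ¬ ∀ i ∈ σ.S, i ∈ σ.maxMeets (↑I)ᶜ ↔ i ∉ I := by
    rw [f₃.reg 11 rfl, q₂, k₃.reg_two]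
    split_ifs with hc
    · exact iff_of_false (by simp) (not_not.2 hc)
    · exact iff_of_true one_pos hc
  have r12 : s₃.reg 12 < s₃.reg 2 ↔ ↑σ.S ⊆ σ.outer I := by
    rw [q₃.2, k₃.reg_two]
    split_ifs with hc <;> simp [hc]
  have reject : ∀ B, 2 ≤ B → σ.Rejects I → Runs T (finish 0) s₃ B fun s' =>
      s'.out = s.out ++ σ.code ∧
      (σ.Rejects I ∧ s'.reg 13 = 0 ∧ s'.reg 14 = 0 ∨
        ¬ σ.Rejects I ∧ σ.clo I = σ.sub I ∧ s'.reg 13 = 0 ∧ s'.reg 14 = 1 ∨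
        ¬ σ.Rejects I ∧ σ.clo I ≠ σ.sub I ∧ s'.reg 13 = s.reg 13 ∧
          Holds I (σ.reduce I) s') := fun B hB hr =>
    runs_finish.mono hB fun s' f' q' => ⟨by rw [f'.out rfl, o₃], .inl ⟨hr, q'⟩⟩
  refine Runs.ifLt (fun hlt => ?_) fun hlt => Runs.ifLt (fun hlt' => ?_) fun hlt' => ?_
  · exact reject _ (by lia) (hσ.rejects_iff.2 (.inl (r11.1 hlt)))
  · exact reject _ (by lia) (hσ.rejects_iff.2 (.inr (r12.1 hlt')))
  have hrej : ¬ σ.Rejects I := by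
    rw [hσ.rejects_iff, ← r11, ← r12]
    tauto
  refine Runs.seq (runs_testClosed hT hn k₃ hσ hI q₃.1) fun s₄ f₄ q₄ => ?_
  have k₄ := k₃.frame f₄ rfl
  have o₄ : s₄.out = s.out ++ σ.code := by rw [f₄.out rfl, o₃]
  have r12' : s₄.reg 1 < s₄.reg 12 ↔ σ.clo I = σ.sub I := by
    rw [q₄.2, k₄.reg_one, hσ.clo_eq_iff hI]
    split_ifs with hc <;> simp [hc]
  refine Runs.ifLt (fun hlt => ?_) fun hlt => ?_
  · exact runs_finish.mono (by lia) fun s' f' q' =>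
      ⟨by rw [f'.out rfl, o₄], .inr (.inl ⟨hrej, r12'.1 hlt, q'⟩)⟩
  · refine (runs_shrink hT hn k₄ hσ q₄.1).mono le_rfl fun s' f' q' =>
      ⟨by rw [f'.out rfl, o₄], .inr (.inr ⟨hrej, mt r12'.2 hlt, ?_, q'⟩)⟩
    rw [f'.reg 13 rfl, f₄.reg 13 rfl, f₃.reg 13 rfl, f₂.reg 13 rfl, f₁.reg 13 rfl]

theorem runs_loop (hT : HoldsTransitions T G) (hn : 0 < n) {l : List (LoopState G)} {ans : Bool}
    (hl : Loop I σ l ans) (h : Holds I σ s) (hσ : σ.Valid) (hI : I ⊆ σ.S) (h13 : s.reg 13 = 1) :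
    Runs T (.whileLt 1 13 body) s (l.length * (600 * (n * G.m₂) + 1) + 1) fun s' =>
      s'.out = s.out ++ l.flatMap LoopState.code ∧ s'.reg 14 = if ans then 1 else 0 := by
  induction hl generalizing s with
  | reject σ hr =>
    obtain ⟨t, s', he, ht, hout, hs'⟩ := runs_body hT hn h hσ hI
    have hlt : s.reg 1 < s.reg 13 := by simp [h.reg_one, h13]
    obtain ⟨-, h13', h14⟩ := (hs'.resolve_right (by tauto))
    refine ⟨_, s', .whileTrue hlt he (.whileFalse (by simp [h13'])), ?_, ?_⟩
    · simp only [List.length_cons, List.length_nil]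
      lia
    · simp [hout, h14]
  | accept σ hr hc =>
    obtain ⟨t, s', he, ht, hout, hs'⟩ := runs_body hT hn h hσ hI
    have hlt : s.reg 1 < s.reg 13 := by simp [h.reg_one, h13]
    obtain ⟨-, -, h13', h14⟩ := (hs'.resolve_left (by tauto)).resolve_right (by tauto)
    refine ⟨_, s', .whileTrue hlt he (.whileFalse (by simp [h13'])), ?_, ?_⟩
    · simp only [List.length_cons, List.length_nil]
      lia
    · simp [hout, h14]
  | reduce σ hr hc l ans hl ih =>
    obtain ⟨t, s', he, ht, hout, hs'⟩ := runs_body hT hn h hσ hI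
    have hlt : s.reg 1 < s.reg 13 := by simp [h.reg_one, h13]
    obtain ⟨-, -, h13', hs'⟩ := (hs'.resolve_left (by tauto)).resolve_left (by tauto)
    obtain ⟨t', s'', he', ht', hout', h14⟩ :=
      ih hs' hσ.reduce (hσ.ssubset_reduce_S hI hr hc).subset (h13'.trans h13)
    refine ⟨_, s'', .whileTrue hlt he he', ?_, ?_, h14⟩
    · rw [List.length_cons, Nat.succ_mul]
      lia
    · rw [hout', hout, List.flatMap_cons, List.append_assoc]

theorem runs_implementation (hT : HoldsTransitions T G) (hn : 0 < n) {l : List (LoopState G)}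
    {ans : Bool} (hl : Algorithm G I l ans) (hlen : l.length ≤ n) :
    Runs T implementation (initialMemory G I) (1000 * (n ^ 2 * G.m₂)) fun s' =>
      s'.out = transcript l ans := by
  classical
  have hM : n ≤ G.m₂ := le_m₂
  have hnM := Nat.le_mul_of_pos_left G.m₂ hn
  have hnnM := Nat.le_mul_of_pos_left (n * G.m₂) hn
  have hsq : n ^ 2 * G.m₂ = n * (n * G.m₂) := by ring
  -- The bound on the number of iterations, proved for the abstract algorithm, turns the cost per
  -- iteration into the total.
  have htime : l.length * (600 * (n * G.m₂) + 1) ≤ n * (600 * (n * G.m₂) + 1) :=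
    Nat.mul_le_mul_right _ hlen
  refine Runs.mono (B := 30 * G.m₂ + 10 + (1 + (1 + (n * (3 + 2) + 2 + (n * (3 + 2) + 2 + (1 +
    (1 + (l.length * (600 * (n * G.m₂) + 1) + 1) + 1 + 1 + 1)))))))
    (Runs.seq runs_setUp fun s₁ f₁ k₁ => Runs.loopFree_seq rfl fun f₂ =>
      Runs.loopFree_seq rfl fun f₃ => ?_) (by rw [hsq]; nlinarith) fun _ _ h => h
  set s₂ := (Program.const 11 0).effect T s₁ with hs₂
  set s₃ := (Program.const 12 0).effect T s₂ with hs₃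
  have k₂ := k₁.frame f₂ rfl
  have k₃ := k₂.frame f₃ rfl
  refine Runs.seq (Runs.forLt_flag (r := 12) (v := 1) rfl rfl rfl rfl k₃.reg_zero rfl
    (fun p => 0 < s₃.arr 2 p) fun p s' hp hf hr => ?_) fun s₄ f₄ q₄ => ?_
  · have h1 : s'.reg 1 = 0 := (hf.reg 1 rfl).trans k₃.reg_one
    have h2 : s'.arr 2 = s₃.arr 2 := hf.arr 2 rfl
    by_cases hS : 0 < s₃.arr 2 p <;> simp [effect, hr, h1, h2, hS]
  have k₄ := k₃.frame f₄ rfl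
  refine Runs.seq (Runs.forLt_flag (r := 11) (v := 1) rfl rfl rfl rfl k₄.reg_zero rfl
    (fun p => ¬ 0 < s₄.arr 2 p) fun p s' hp hf hr => ?_) fun s₅ f₅ q₅ => ?_
  · have h1 : s'.reg 1 = 0 := (hf.reg 1 rfl).trans k₄.reg_one
    have h2 : s'.arr 2 = s₄.arr 2 := hf.arr 2 rfl
    by_cases hS : 0 < s₄.arr 2 p <;> simp [effect, hr, h1, h2, hS]
  have k₅ := k₄.frame f₅ rfl
  refine Runs.loopFree_seq rfl fun f₆ => ?_
  set s₆ := (Program.const 14 0).effect T s₅ with hs₆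
  have k₆ := k₅.frame f₆ rfl
  have r12 : s₆.reg 1 < s₆.reg 12 ↔ I ≠ ∅ := by
    have key : (∃ p < n, 0 < s₃.arr 2 p) ↔ I ≠ ∅ := by
      rw [exists_lt_iff_fin, ← Finset.nonempty_iff_ne_empty]
      simp only [k₃.target.pos_iff]
      rfl
    rw [k₆.reg_one, f₆.reg 12 rfl, f₅.reg 12 rfl, q₄]
    simp only [key]
    split_ifs with hc <;> simp [hc, hs₃, effect]
  have r11 : s₆.reg 1 < s₆.reg 11 ↔ I ≠ Finset.univ := by
    have key : (∃ p < n, ¬ 0 < s₄.arr 2 p) ↔ I ≠ Finset.univ := by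
      rw [exists_lt_iff_fin, Ne, Finset.eq_univ_iff_forall, not_forall]
      simp only [k₄.target.pos_iff]
      rfl
    rw [k₆.reg_one, f₆.reg 11 rfl, q₅, f₄.reg 11 rfl, f₃.reg 11 rfl]
    simp only [key]
    split_ifs with hc <;> simp [hc, hs₂, effect]
  have out₆ : s₆.out = [] := by
    rw [f₆.out rfl, f₅.out rfl, f₄.out rfl, f₃.out rfl, f₂.out rfl, f₁.out rfl]
    rfl
  have r14 : s₆.reg 14 = 0 := by simp [hs₆, effect]
  refine Runs.seq (Q := fun s' => s'.out = l.flatMap LoopState.code ∧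
    s'.reg 14 = if ans then 1 else 0) ?_ fun s₇ _ q₇ =>
      Runs.of_loopFree rfl (by simp [effect, q₇, transcript])
  cases hl with
  | empty hI =>
    refine Runs.ifLt (fun hlt => (r12.1 hlt hI).elim) fun _ => ?_
    exact (Runs.of_loopFree (c := .skip) rfl
      (Q := fun s' => s' = s₆) rfl).mono (by simp [size]) (by
        rintro _ - rfl
        simp [out₆, r14])
  | whole hI hI' =>
    refine Runs.ifLt (fun _ => Runs.ifLt (fun hlt => (r11.1 hlt hI').elim) fun _ => ?_)
      fun hlt => (hlt (r12.2 hI)).elim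
    exact (Runs.of_loopFree (c := .const 14 1) rfl
      (Q := fun s' => s'.out = [] ∧ s'.reg 14 = 1) (by simp [effect, out₆])).mono
        (by simp [size]) (by simp)
  | loop hI hI' _ _ hl =>
    refine Runs.ifLt (fun _ => Runs.ifLt (fun _ => ?_) fun hlt => (hlt (r11.2 hI')).elim)
      fun hlt => (hlt (r12.2 hI)).elim
    refine Runs.loopFree_seq rfl fun f₇ => ?_
    refine (runs_loop hT hn hl (k₆.frame f₇ rfl) LoopState.valid_full (Finset.subset_univ _)
      (by simp [effect])).mono le_rfl fun s' _ q => ⟨?_, q.2⟩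
    rw [q.1, f₇.out rfl, out₆, List.nil_append]

end Routines

end ShapleyGame

theorem theorem6p9 :
    -- one implementation of the algorithm and one constant for all inputs
    ∃ (prog : ShapleyGame.Program) (C : ℕ),
      ∀ (n : ℕ) (_hn : 0 < n) (G : ShapleyGame.Game n) (I : Finset (Fin n)),
        ∃ (l : List (ShapleyGame.LoopState G)) (ans : Bool),
          -- the algorithm terminates, after at most `n` iterations of its loop
          ShapleyGame.Algorithm G I l ans ∧ l.length ≤ n ∧
          -- its answer is right
          (ans = true ↔
            ∃ u : Fin n → ℝ, ShapleyGame.shapley G.P u = u ∧ ShapleyGame.argmin u = ↑I) ∧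
          -- the implementation goes through the same iterations, returns the same answer, and
          -- takes `O(n² m₂)` time
          (∀ T : ℕ → ℕ → ℝ, ShapleyGame.HoldsTransitions T G →
            ∃ (t : ℕ) (s : ShapleyGame.Memory),
              ShapleyGame.Exec T prog (ShapleyGame.initialMemory G I) t s ∧
              s.out = ShapleyGame.transcript l ans ∧
              t ≤ C * (n ^ 2 * G.m₂)) ∧
          n ^ 2 * G.m₂ ≤ n ^ 3 * G.m ^ 2 := by
  refine ⟨ShapleyGame.implementation, 1000, fun n hn G I => ?_⟩
  obtain ⟨l, ans, hl, hlen, hans⟩ := ShapleyGame.exists_algorithm hn G I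
  refine ⟨l, ans, hl, hlen, hans, fun T hT => ?_, ?_⟩
  · obtain ⟨t, s, he, ht, hout⟩ := ShapleyGame.runs_implementation hT hn hl hlen
    exact ⟨t, s, he, hout, ht⟩
  · calc n ^ 2 * G.m₂ ≤ n ^ 2 * (n * G.m ^ 2) := Nat.mul_le_mul_left _ G.m₂_le
      _ = n ^ 3 * G.m ^ 2 := by ring
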